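/- A connected simplicial graph is *median* if for all vertices $v_1,v_2,v_3$ there is a unique vertex $\mu$ with $d(v_i,v_j)=d(v_i,\mu)+d(\mu,v_j)$ for all $i\neq j$. A *CAT(0) cube complex* is the cell complex $X$ obtained from a median graph by attaching a unit cube $[0,1]^n$ to every subgraph isometric to a Cartesian product of $n$ edges, for every $n\ge 2$ (with the obvious identifications along faces). It is *finite-dimensional* if the dimensions of its cubes are bounded. It is equipped with its CAT(0) metric, that is, the length metric $d_2$ obtained by giving every cube the Euclidean metric. A map $f:A\to B$ of metric spaces is a *quasiisometry* if for some $q\ge1$ one has $\frac1q d(a,a')-q\le d(f(a),f(a'))\le q\,d(a,a')+q$ for all $a,a'\in A$, and every point of $B$ is within distance $q$ of $f(A)$; two spaces are *quasiisometric* if there is a quasiisometry between them. Let $X$ be a finite-dimensional CAT(0) cube complex (not necessarily proper or locally finite). 1. If $X$ is quasiisometric to $\mathbb{R}$, then $X$ contains a biinfinite CAT(0) geodesic, i.e. there is an isometric embedding $\mathbb{R}\to(X,d_2)$. 2. If $X$ is quasiisometric to $[0,\infty)\subset\mathbb{R}$, then $X$ contains a CAT(0) geodesic ray, i.e. there is an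 isometric embedding $[0,\infty)\to(X,d_2)$. -/

import Mathlib

/-- A simplicial graph is *median* if it is connected and any three vertices `u, v, w` have a unique
median, i.e. a vertex `m` lying on a geodesic between any two of them. -/
class IsMedianGraph {V : Type*} (G : SimpleGraph V) : Prop where
  connected : G.Connected
  existsUnique_median : ∀ u v w : V, ∃! m : V,
    G.dist u v = G.dist u m + G.dist m v ∧
    G.dist v w = G.dist v m + G.dist m w ∧
    G.dist u w = G.dist u m + G.dist m w

/-- `c` parametrises the vertices of an `n`-cube of `G`: it is an isometric embedding of the
product of `n` edges (the vertex set `{0,1}ⁿ` with the Hamming distance) into `G`.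
For `n = 0, 1` these are the vertices and the edges of `G`. -/
def IsGraphCube {V : Type*} (G : SimpleGraph V) {n : ℕ} (c : (Fin n → Bool) → V) : Prop :=
  ∀ a b, G.dist (c a) (c b) = hammingDist a b

/-- The unit cube `[0,1]ⁿ` in Euclidean space. -/
def unitCube (n : ℕ) : Set (EuclideanSpace ℝ (Fin n)) :=
  {s | ∀ i, s i ∈ Set.Icc (0 : ℝ) 1}

/-- The point with coordinates `s ∈ [0,1]ⁿ` in the cube with vertices `c a`, `a ∈ {0,1}ⁿ`.
The vertices of the graph are the standard basis of `ℝ^(V)`, and the cube is the image of `[0,1]ⁿ`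
under the multilinear interpolation of its vertices (so the `v`-coordinate of the point is
its weight at the vertex `v`). This is injective on each cube, and it is compatible with passing
to faces and with the symmetries of the cube; points of two cubes have the same image
exactly when they are the same point of a common face. -/
noncomputable def cubePoint {V : Type*} {n : ℕ} (c : (Fin n → Bool) → V)
    (s : EuclideanSpace ℝ (Fin n)) : V →₀ ℝ :=
  ∑ a : Fin n → Bool, Finsupp.single (c a) (∏ i, if a i then s i else 1 - s i)

/-- The (underlying set of the) cube complex obtained from the graph `G` by attaching a unit cube to
every subgraph isometric to a product of edges. For a median graph `G` this is
the CAT(0) cube complex with 1-skeleton `G`. -/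
def CubeComplex {V : Type*} (G : SimpleGraph V) : Type _ :=
  {x : V →₀ ℝ // ∃ (n : ℕ) (c : (Fin n → Bool) → V) (s : EuclideanSpace ℝ (Fin n)),
    IsGraphCube G c ∧ s ∈ unitCube n ∧ x = cubePoint c s}

/-- The cube complex has finite dimension: the dimensions of its cubes are bounded. -/
def CubeComplex.FiniteDimensional {V : Type*} (G : SimpleGraph V) : Prop :=
  ∃ N : ℕ, ∀ (n : ℕ) (c : (Fin n → Bool) → V), IsGraphCube G c → n ≤ N

namespace CubeComplex

/-- `x` and `y` lie in a common cube, with Euclidean distance `r` there. -/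
def InCubeAtDist {V : Type*} (G : SimpleGraph V) (x y : CubeComplex G) (r : ℝ) : Prop :=
  ∃ (n : ℕ) (c : (Fin n → Bool) → V) (s t : EuclideanSpace ℝ (Fin n)),
    IsGraphCube G c ∧ s ∈ unitCube n ∧ t ∈ unitCube n ∧
    x.1 = cubePoint c s ∧ y.1 = cubePoint c t ∧ r = dist s t

/-- `x` and `y` are joined by a piecewise linear path of length `ℓ`: a finite sequence of
points from `x` to `y`, consecutive ones lying in a common cube, whose Euclidean
distances in these cubes add up to `ℓ`. -/
inductive PathOfLength {V : Type*} (G : SimpleGraph V) :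
    CubeComplex G → CubeComplex G → ℝ → Prop
  | refl (x : CubeComplex G) : PathOfLength G x x 0
  | snoc {x y z : CubeComplex G} {ℓ r : ℝ} :
      PathOfLength G x y ℓ → InCubeAtDist G y z r → PathOfLength G x z (ℓ + r)

/-- The length metric `d₂` induced by the Euclidean (`ℓ²`) metrics on the cubes. -/
noncomputable def pathDist {V : Type*} (G : SimpleGraph V) (x y : CubeComplex G) : ℝ :=
  sInf {ℓ : ℝ | PathOfLength G x y ℓ}

section
variable {V : Type*} {G : SimpleGraph V}

theorem InCubeAtDist.symm {x y : CubeComplex G} {r : ℝ} (h : InCubeAtDist G x y r) :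
    InCubeAtDist G y x r := by
  obtain ⟨n, c, s, t, hc, hs, ht, hx, hy, rfl⟩ := h
  exact ⟨n, c, t, s, hc, ht, hs, hy, hx, dist_comm _ _⟩

theorem PathOfLength.nonneg {x y : CubeComplex G} {ℓ : ℝ} (h : PathOfLength G x y ℓ) :
    0 ≤ ℓ := by
  induction h with
  | refl => exact le_rfl
  | snoc _ h ih =>
    obtain ⟨n, c, s, t, -, -, -, -, -, rfl⟩ := h
    exact add_nonneg ih dist_nonneg

theorem PathOfLength.trans {x y z : CubeComplex G} {ℓ r : ℝ} (h : PathOfLength G x y ℓ)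
    (h' : PathOfLength G y z r) : PathOfLength G x z (ℓ + r) := by
  induction h' with
  | refl => simpa using h
  | snoc _ h₂ ih => rw [← add_assoc]; exact ih.snoc h₂

theorem InCubeAtDist.path {x y : CubeComplex G} {r : ℝ} (h : InCubeAtDist G x y r) :
    PathOfLength G x y r := by
  simpa using (PathOfLength.refl x).snoc h

theorem PathOfLength.symm {x y : CubeComplex G} {ℓ : ℝ} (h : PathOfLength G x y ℓ) :
    PathOfLength G y x ℓ := by
  induction h with
  | refl => exact .refl _
  | snoc _ h ih => rw [add_comm]; exact h.symm.path.trans ih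

theorem bddBelow_pathLengths (x y : CubeComplex G) :
    BddBelow {ℓ : ℝ | PathOfLength G x y ℓ} :=
  ⟨0, fun _ h => PathOfLength.nonneg h⟩

/-- The corner of the unit cube given by `a ∈ {0,1}ⁿ`. -/
noncomputable def corner {n : ℕ} (a : Fin n → Bool) : EuclideanSpace ℝ (Fin n) :=
  WithLp.toLp 2 fun i => if a i then 1 else 0

theorem corner_mem {n : ℕ} (a : Fin n → Bool) : corner a ∈ unitCube n := by
  intro i
  by_cases h : a i <;> simp [corner, h]

theorem cubePoint_corner {n : ℕ} (c : (Fin n → Bool) → V) (a : Fin n → Bool) :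
    cubePoint c (corner a) = Finsupp.single (c a) 1 := by
  unfold cubePoint
  rw [Finset.sum_eq_single a]
  · congr 1
    refine Finset.prod_eq_one fun i _ => ?_
    by_cases h : a i <;> simp [corner, h]
  · intro b _ hb
    obtain ⟨i, hi⟩ := Function.ne_iff.mp hb
    rw [Finset.prod_eq_zero (Finset.mem_univ i), Finsupp.single_zero]
    cases h : a i <;> cases h' : b i <;> simp_all [corner]
  · simp

/-- The vertices of the graph, as points of the complex. -/
noncomputable def vertex (G : SimpleGraph V) (v : V) : CubeComplex G :=
  ⟨Finsupp.single v 1, 0, fun _ => v, corner ![],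
    fun a b => by simp [Subsingleton.elim a b], corner_mem _,
    (cubePoint_corner (fun _ : Fin 0 → Bool => v) ![]).symm⟩

theorem exists_path_vertex (x : CubeComplex G) : ∃ v ℓ, PathOfLength G x (vertex G v) ℓ := by
  obtain ⟨x, n, c, s, hc, hs, rfl⟩ := x
  refine ⟨c fun _ => false, _, InCubeAtDist.path
    ⟨n, c, s, corner fun _ => false, hc, hs, corner_mem _, rfl, ?_, rfl⟩⟩
  rw [cubePoint_corner]; rfl

theorem exists_path_of_adj {u v : V} (h : G.Adj u v) :
    ∃ ℓ, PathOfLength G (vertex G u) (vertex G v) ℓ := by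
  refine ⟨_, InCubeAtDist.path ⟨1, fun a => if a 0 then v else u, corner fun _ => false,
    corner fun _ => true, ?_, corner_mem _, corner_mem _, ?_, ?_, rfl⟩⟩
  · have h1 : G.dist u v = 1 := SimpleGraph.dist_eq_one_iff_adj.mpr h
    have h2 : G.dist v u = 1 := SimpleGraph.dist_eq_one_iff_adj.mpr h.symm
    intro a b
    cases ha : a 0 <;> cases hb : b 0 <;> 
      simp [hammingDist, Finset.filter_singleton, ha, hb, h1, h2]
  · rw [cubePoint_corner]; simp [vertex]
  · rw [cubePoint_corner]; simp [vertex]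

theorem exists_path (hG : G.Connected) (x y : CubeComplex G) : ∃ ℓ, PathOfLength G x y ℓ := by
  obtain ⟨u, l₁, h₁⟩ := exists_path_vertex x
  obtain ⟨v, l₂, h₂⟩ := exists_path_vertex y
  have key : ∀ {u v : V}, G.Walk u v → ∃ ℓ, PathOfLength G (vertex G u) (vertex G v) ℓ := by
    intro u v p
    induction p with
    | nil => exact ⟨_, .refl _⟩
    | cons h _ ih =>
      obtain ⟨l, hl⟩ := ih
      obtain ⟨l', hl'⟩ := exists_path_of_adj h
      exact ⟨_, hl'.trans hl⟩
  obtain ⟨p⟩ := hG.preconnected u v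
  obtain ⟨l, hl⟩ := key p
  exact ⟨_, (h₁.trans hl).trans h₂.symm⟩

end

/-- The CAT(0) cube complex of a median graph, with the length metric `d₂`. -/
noncomputable instance {V : Type*} (G : SimpleGraph V) [IsMedianGraph G] :
    PseudoMetricSpace (CubeComplex G) where
  dist := pathDist G
  dist_self x := le_antisymm (csInf_le (bddBelow_pathLengths x x) (.refl x))
    (Real.sInf_nonneg fun _ h => PathOfLength.nonneg h)
  dist_comm x y := congrArg sInf (Set.ext fun _ => ⟨.symm, .symm⟩)
  dist_triangle x y z := by
    have hG : G.Connected := IsMedianGraph.connected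
    refine le_of_forall_pos_le_add fun ε hε => ?_
    obtain ⟨l, hl, hl'⟩ := exists_lt_of_csInf_lt (exists_path hG x y)
      (lt_add_of_pos_right (pathDist G x y) (half_pos hε))
    obtain ⟨r, hr, hr'⟩ := exists_lt_of_csInf_lt (exists_path hG y z)
      (lt_add_of_pos_right (pathDist G y z) (half_pos hε))
    have := csInf_le (bddBelow_pathLengths x z) (hl.trans hr)
    change pathDist G x z ≤ pathDist G x y + pathDist G y z + ε
    unfold pathDist at *
    linarith

/-- In finite dimension (the only case used below) `d₂` separates points, so it is a metric. -/
theorem eq_of_dist_eq_zero {V : Type*} {G : SimpleGraph V} [IsMedianGraph G]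
    (hdim : FiniteDimensional G) {x y : CubeComplex G} (h : dist x y = 0) : x = y := by
  obtain ⟨N, hN⟩ := hdim
  have hprod : ∀ {n : ℕ} (f g : Fin n → ℝ), (∀ i, |f i| ≤ 1) → (∀ i, |g i| ≤ 1) →
      |∏ i, f i - ∏ i, g i| ≤ ∑ i, |f i - g i| := by
    intro n f g hf hg
    induction n with
    | zero => simp
    | succ n ih =>
      rw [Fin.prod_univ_succ, Fin.prod_univ_succ, Fin.sum_univ_succ]
      have h1 := ih (fun i => f i.succ) (fun i => g i.succ) (fun i => hf _) (fun i => hg _)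
      have h2 : |∏ i : Fin n, g i.succ| ≤ 1 := by
        rw [Finset.abs_prod]
        exact Finset.prod_le_one (fun _ _ => abs_nonneg _) fun i _ => hg _
      calc |f 0 * ∏ i : Fin n, f i.succ - g 0 * ∏ i : Fin n, g i.succ|
          = |(f 0 - g 0) * ∏ i : Fin n, g i.succ
              + f 0 * (∏ i : Fin n, f i.succ - ∏ i : Fin n, g i.succ)| := by ring_nf
        _ ≤ |f 0 - g 0| * 1 + 1 * ∑ i : Fin n, |f i.succ - g i.succ| := by
            refine (abs_add_le _ _).trans (add_le_add ?_ ?_) <;> rw [abs_mul]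
            · exact mul_le_mul_of_nonneg_left h2 (abs_nonneg _)
            · exact mul_le_mul (hf 0) h1 (abs_nonneg _) zero_le_one
        _ = _ := by ring
  have hstep : ∀ {x y : CubeComplex G} {r : ℝ}, InCubeAtDist G x y r →
      ∀ v, |x.1 v - y.1 v| ≤ 2 ^ N * N * r := by
    rintro x y r ⟨n, c, s, t, hc, hs, ht, hx, hy, rfl⟩ v
    have hn : n ≤ N := hN n c hc
    rw [hx, hy]
    unfold cubePoint
    rw [Finsupp.finsetSum_apply, Finsupp.finsetSum_apply, ← Finset.sum_sub_distrib]
    have hc' : ∀ {s : EuclideanSpace ℝ (Fin n)}, s ∈ unitCube n → ∀ (a : Fin n → Bool) (i : Fin n),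
        |if a i then s i else 1 - s i| ≤ 1 := by
      intro s hs a i
      have := hs i
      simp only [Set.mem_Icc] at this
      split_ifs <;> rw [abs_le] <;> constructor <;> linarith
    have hterm : ∀ a : Fin n → Bool,
        |Finsupp.single (c a) (∏ i, if a i then s i else 1 - s i) v
          - Finsupp.single (c a) (∏ i, if a i then t i else 1 - t i) v| ≤ n * dist s t := by
      intro a
      have hd : |(∏ i, if a i then s i else 1 - s i) - ∏ i, if a i then t i else 1 - t i|
          ≤ n * dist s t := by
        refine (hprod _ _ (hc' hs a) (hc' ht a)).trans ?_
        refine (Finset.sum_le_card_nsmul _ _ (dist s t) fun i _ => ?_).trans (by simp)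
        have h1 : |s i - t i| ≤ dist s t := by
          rw [dist_eq_norm]
          simpa using PiLp.norm_apply_le (s - t) i
        split_ifs
        · exact h1
        · rw [abs_sub_comm] at h1
          simpa using h1
      by_cases hv : c a = v
      · simpa [hv] using hd
      · simpa [Finsupp.single_apply, hv] using by positivity
    refine (Finset.abs_sum_le_sum_abs _ _).trans
      ((Finset.sum_le_card_nsmul _ _ _ fun a _ => hterm a).trans ?_)
    simp only [Finset.card_univ, Fintype.card_pi, Fintype.card_bool, Finset.prod_const,
      Fintype.card_fin, nsmul_eq_mul, Nat.cast_pow, Nat.cast_ofNat, ← mul_assoc]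
    gcongr
    norm_num
  have hpath : ∀ {x y : CubeComplex G} {r : ℝ}, PathOfLength G x y r →
      ∀ v, |x.1 v - y.1 v| ≤ 2 ^ N * N * r := by
    intro x y r h v
    induction h with
    | refl => simp
    | snoc _ h ih =>
      rw [mul_add]
      exact (abs_sub_le _ _ _).trans (add_le_add ih (hstep h v))
  refine Subtype.ext (Finsupp.ext fun v => ?_)
  by_contra hne
  have hpos : 0 < |x.1 v - y.1 v| := abs_pos.mpr (sub_ne_zero.mpr hne)
  have hK : (0 : ℝ) < 2 ^ N * N + 1 := by positivity
  obtain ⟨l, hl, hl'⟩ := exists_lt_of_csInf_lt (exists_path IsMedianGraph.connected x y)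
    (show pathDist G x y < |x.1 v - y.1 v| / (2 ^ N * N + 1) from h.trans_lt (div_pos hpos hK))
  rw [lt_div_iff₀ hK] at hl'
  have := hpath hl v
  have := PathOfLength.nonneg hl
  linarith

end CubeComplex

/-- `f` is a quasiisometry: a quasiisometric embedding with coarsely dense image. -/
def IsQuasiIsometry {X Y : Type*} [PseudoMetricSpace X] [PseudoMetricSpace Y] (f : X → Y) : Prop :=
  ∃ q : ℝ, 1 ≤ q ∧
    (∀ x x' : X, q⁻¹ * dist x x' - q ≤ dist (f x) (f x') ∧ dist (f x) (f x') ≤ q * dist x x' + q) ∧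
    ∀ y : Y, ∃ x : X, dist (f x) y ≤ q

/-- `X` and `Y` are quasiisometric. (This relation is symmetric.) -/
def QuasiIsometric (X Y : Type*) [PseudoMetricSpace X] [PseudoMetricSpace Y] : Prop :=
  ∃ f : X → Y, IsQuasiIsometry f


/-!
A subset `S` of the line has two ends, and a quasiisometry `f` from `S` to the complex carries them
to two ultrafilters `𝒜` and `ℬ` on the vertices of the median graph `G`. Send a vertex `x` to its
median `φ x` with these ends. A halfspace that contains `φ x` belongs to `𝒜` or to `ℬ`, so `φ` is
idempotent, and in finite dimension only finitely many edges at a vertex lead to fixed points of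
`φ`: the image of `φ` is locally finite although `G` need not be. Geodesics of `G` between points
near `f a` and `f b` have to pass near `f k` for all `a ≤ k ≤ b`, so `φ` moves the vertices near
the image of `f` by a bounded amount.

As `φ` maps cubes to cubes by coordinate projections, it extends to a 1-Lipschitz retraction of the
complex. Its image `Z` is a length subspace, has relatively compact balls and stays close to the
image of `f`. In `Z` there are almost geodesics between points far out towards the two ends, all
passing through the same ball, or from one point to points arbitrarily far away. Their pointwise
limit along an ultrafilter is a biinfinite geodesic or a geodesic ray.
-/

/-! ## Geodesics and halfspaces in median graphs -/

/-- `GeodBtw G x y z` says that `y` lies on a geodesic of `G` from `x` to `z`. -/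
def GeodBtw {V : Type*} (G : SimpleGraph V) (x y z : V) : Prop :=
  G.dist x z = G.dist x y + G.dist y z

namespace GeodBtw

variable {V : Type*} {G : SimpleGraph V} {w x y z : V}

theorem symm (h : GeodBtw G x y z) : GeodBtw G z y x := by
  unfold GeodBtw at *
  rw [G.dist_comm (u := z), G.dist_comm (u := z) (v := y), G.dist_comm (u := y) (v := x)]
  omega

theorem trans_left (hG : G.Connected) (h : GeodBtw G w y z) (h' : GeodBtw G w x y) :
    GeodBtw G w x z := by
  have := hG.dist_triangle (u := x) (v := y) (w := z)
  have := hG.dist_triangle (u := w) (v := x) (w := z)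
  unfold GeodBtw at *
  omega

theorem trans_left_right (hG : G.Connected) (h : GeodBtw G w y z) (h' : GeodBtw G w x y) :
    GeodBtw G x y z := by
  have := hG.dist_triangle (u := x) (v := y) (w := z)
  have := hG.dist_triangle (u := w) (v := x) (w := z)
  unfold GeodBtw at *
  omega

theorem trans_right (hG : G.Connected) (h : GeodBtw G w x z) (h' : GeodBtw G x y z) :
    GeodBtw G w y z :=
  (h.symm.trans_left hG h'.symm).symm

theorem antisymm (hG : G.Connected) (h : GeodBtw G x y z) (h' : GeodBtw G x z y) : y = z := by
  refine hG.dist_eq_zero_iff.mp ?_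
  unfold GeodBtw at *
  rw [G.dist_comm (u := z)] at h'
  omega

end GeodBtw

theorem exists_adj_geodBtw {V : Type*} {G : SimpleGraph V} (hG : G.Connected) {x y : V}
    (h : x ≠ y) : ∃ x', G.Adj x x' ∧ GeodBtw G x x' y := by
  obtain ⟨p, hp⟩ := hG.exists_walk_length_eq_dist x y
  cases p with
  | nil => exact absurd rfl h
  | @cons _ x' _ hadj q =>
    refine ⟨x', hadj, ?_⟩
    have h_edge : G.dist x x' = 1 := SimpleGraph.dist_eq_one_iff_adj.mpr hadj
    have h_tail := SimpleGraph.dist_le q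
    have h_triangle := hG.dist_triangle (u := x) (v := x') (w := y)
    rw [SimpleGraph.Walk.length_cons] at hp
    unfold GeodBtw
    omega

/-- The vertices closer to `a` than to `b`; the halfspaces of a median graph are these sets for
adjacent `a` and `b`. -/
def halfspace {V : Type*} (G : SimpleGraph V) (a b : V) : Set V := {x | G.dist x a < G.dist x b}

/-- `W` is one of the two sides of some edge of `G`. -/
def IsHalfspace {V : Type*} (G : SimpleGraph V) (W : Set V) : Prop :=
  ∃ a b, G.Adj a b ∧ W = halfspace G a b

section

variable {V : Type*} {G : SimpleGraph V} {a b : V}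

theorem left_mem_halfspace (h : G.Adj a b) : a ∈ halfspace G a b := by
  simp [halfspace, SimpleGraph.dist_eq_one_iff_adj.mpr h]

theorem right_notMem_halfspace : b ∉ halfspace G a b := by
  simp [halfspace]

theorem isHalfspace_halfspace (h : G.Adj a b) : IsHalfspace G (halfspace G a b) :=
  ⟨a, b, h, rfl⟩

end

namespace IsMedianGraph

variable {V : Type*} {G : SimpleGraph V} [IsMedianGraph G] {a b x y z : V} {W : Set V}

/-- The median of three vertices of a median graph. -/
noncomputable def med (G : SimpleGraph V) [IsMedianGraph G] (u v w : V) : V :=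
  (existsUnique_median (G := G) u v w).choose

theorem geodBtw_med₁₂ (u v w : V) : GeodBtw G u (med G u v w) v :=
  (existsUnique_median (G := G) u v w).choose_spec.1.1

theorem geodBtw_med₂₃ (u v w : V) : GeodBtw G v (med G u v w) w :=
  (existsUnique_median (G := G) u v w).choose_spec.1.2.1

theorem geodBtw_med₁₃ (u v w : V) : GeodBtw G u (med G u v w) w :=
  (existsUnique_median (G := G) u v w).choose_spec.1.2.2

theorem eq_med {u v w m : V} (h₁₂ : GeodBtw G u m v) (h₂₃ : GeodBtw G v m w)
    (h₁₃ : GeodBtw G u m w) : m = med G u v w :=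
  (existsUnique_median (G := G) u v w).choose_spec.2 m ⟨h₁₂, h₂₃, h₁₃⟩

theorem geodBtw_or_geodBtw_of_adj (h : G.Adj a b) (x : V) :
    GeodBtw G x a b ∨ GeodBtw G x b a := by
  have h_ab := SimpleGraph.dist_eq_one_iff_adj.mpr h
  have h_ba := SimpleGraph.dist_eq_one_iff_adj.mpr h.symm
  have h₁₂ := geodBtw_med₁₂ (G := G) a b x
  have h₂₃ := geodBtw_med₂₃ (G := G) a b x
  have h₁₃ := geodBtw_med₁₃ (G := G) a b x
  generalize med G a b x = m at *
  unfold GeodBtw at *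
  rw [G.dist_comm (u := x) (v := a), G.dist_comm (u := x) (v := b)]
  rw [G.dist_comm (u := b) (v := m)] at h₂₃
  omega

theorem mem_halfspace_iff (h : G.Adj a b) : x ∈ halfspace G a b ↔ GeodBtw G x a b := by
  have h_ab := SimpleGraph.dist_eq_one_iff_adj.mpr h
  have h_ba := SimpleGraph.dist_eq_one_iff_adj.mpr h.symm
  have := geodBtw_or_geodBtw_of_adj h x
  simp only [halfspace, Set.mem_ofPred_eq, GeodBtw] at *
  omega

theorem compl_halfspace (h : G.Adj a b) : (halfspace G a b)ᶜ = halfspace G b a := by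
  ext x
  have h_ab := SimpleGraph.dist_eq_one_iff_adj.mpr h
  have h_ba := SimpleGraph.dist_eq_one_iff_adj.mpr h.symm
  have := geodBtw_or_geodBtw_of_adj h x
  simp only [halfspace, Set.mem_ofPred_eq, Set.mem_compl_iff, GeodBtw] at *
  omega

theorem notMem_halfspace_iff (h : G.Adj a b) : x ∉ halfspace G a b ↔ GeodBtw G x b a := by
  rw [← Set.mem_compl_iff, compl_halfspace h, mem_halfspace_iff h.symm]

theorem _root_.IsHalfspace.compl (hW : IsHalfspace G W) : IsHalfspace G Wᶜ := by
  obtain ⟨a, b, hab, rfl⟩ := hW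
  exact ⟨b, a, hab.symm, compl_halfspace hab⟩

theorem mem_halfspace_of_geodBtw (h : G.Adj a b) (hx : x ∈ halfspace G a b)
    (hy : GeodBtw G x y a) : y ∈ halfspace G a b :=
  (mem_halfspace_iff h).mpr (((mem_halfspace_iff h).mp hx).trans_left_right connected hy)

/-- If `z` were on the other side, the vertices `x`, `y`, `b` would have a median on either side
of the edge `ab`: one between `x`, `y` and `a`, the other one between `z` and `b`. -/
theorem halfspace_convex (h : G.Adj a b) (hx : x ∈ halfspace G a b) (hy : y ∈ halfspace G a b)
    (hz : GeodBtw G x z y) : z ∈ halfspace G a b := by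
  by_contra hza
  rw [← Set.mem_compl_iff, compl_halfspace h] at hza
  have hG : G.Connected := connected
  set s := med G z x b
  set t := med G z y b
  set n := med G s t b
  set m := med G x y a
  have hn : n ∈ halfspace G b a :=
    mem_halfspace_of_geodBtw h.symm
      (mem_halfspace_of_geodBtw h.symm hza (geodBtw_med₁₃ z x b)) (geodBtw_med₁₃ s t b)
  have hm : m ∈ halfspace G a b := mem_halfspace_of_geodBtw h hx (geodBtw_med₁₃ x y a)
  have hxsz : GeodBtw G x s z := (geodBtw_med₁₂ z x b).symm
  have hsny : GeodBtw G s n y :=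
    ((hz.trans_left_right hG hxsz).trans_right hG (geodBtw_med₁₂ z y b)).trans_left hG
      (geodBtw_med₁₂ s t b)
  have hn_med : n = med G x y b :=
    eq_med ((hz.trans_left hG hxsz).trans_right hG hsny)
      ((geodBtw_med₂₃ z y b).trans_right hG (geodBtw_med₂₃ s t b))
      ((geodBtw_med₂₃ z x b).trans_right hG (geodBtw_med₁₃ s t b))
  have hm_med : m = med G x y b :=
    eq_med (geodBtw_med₁₂ x y a)
      (((mem_halfspace_iff h).mp hy).trans_left hG (geodBtw_med₂₃ x y a))
      (((mem_halfspace_iff h).mp hx).trans_left hG (geodBtw_med₁₃ x y a))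
  rw [← compl_halfspace h, hn_med, ← hm_med] at hn
  exact hn hm

theorem _root_.IsHalfspace.convex (hW : IsHalfspace G W) (hx : x ∈ W) (hy : y ∈ W)
    (hz : GeodBtw G x z y) : z ∈ W := by
  obtain ⟨a, b, h, rfl⟩ := hW
  exact halfspace_convex h hx hy hz

theorem _root_.IsHalfspace.med_mem (hW : IsHalfspace G W)
    (h : (x ∈ W ∧ y ∈ W) ∨ (y ∈ W ∧ z ∈ W) ∨ (x ∈ W ∧ z ∈ W)) : med G x y z ∈ W := by
  rcases h with ⟨hx, hy⟩ | ⟨hy, hz⟩ | ⟨hx, hz⟩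
  · exact hW.convex hx hy (geodBtw_med₁₂ x y z)
  · exact hW.convex hy hz (geodBtw_med₂₃ x y z)
  · exact hW.convex hx hz (geodBtw_med₁₃ x y z)

theorem _root_.IsHalfspace.med_mem_iff (hW : IsHalfspace G W) :
    med G x y z ∈ W ↔ (x ∈ W ∧ y ∈ W) ∨ (y ∈ W ∧ z ∈ W) ∨ (x ∈ W ∧ z ∈ W) := by
  refine ⟨fun h => ?_, hW.med_mem⟩
  by_contra hc
  refine hW.compl.med_mem ?_ h
  simp only [Set.mem_compl_iff]
  tauto

theorem geodBtw_of_forall_halfspace (h : ∀ W, IsHalfspace G W → x ∈ W → z ∈ W → y ∈ W) :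
    GeodBtw G x y z := by
  have hG : G.Connected := connected
  by_contra hn
  have hne : y ≠ med G x y z := fun he => hn (he ▸ geodBtw_med₁₃ (G := G) x y z)
  obtain ⟨y', hadj, hy'⟩ := exists_adj_geodBtw hG hne
  have hx : x ∈ halfspace G y' y := (mem_halfspace_iff hadj.symm).mpr
    ((geodBtw_med₁₂ x y z).symm.trans_left hG hy' |>.symm)
  have hz : z ∈ halfspace G y' y := (mem_halfspace_iff hadj.symm).mpr
    ((geodBtw_med₂₃ x y z).trans_left hG hy' |>.symm)
  exact right_notMem_halfspace (h _ (isHalfspace_halfspace hadj.symm) hx hz)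

theorem eq_of_forall_halfspace (h : ∀ W, IsHalfspace G W → x ∈ W → y ∈ W) : x = y := by
  by_contra hne
  obtain ⟨x', hadj, hx'⟩ := exists_adj_geodBtw (connected (G := G)) hne
  exact (notMem_halfspace_iff (G := G) hadj).mpr hx'.symm
    (h _ (isHalfspace_halfspace hadj) (left_mem_halfspace hadj))

theorem _root_.IsHalfspace.eq_halfspace (hW : IsHalfspace G W) (h : G.Adj a b) (ha : a ∈ W)
    (hb : b ∉ W) : W = halfspace G a b := by
  ext z
  refine ⟨fun hz => ?_, fun hz => ?_⟩
  · by_contra hz'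
    exact hb (hW.convex hz ha ((notMem_halfspace_iff h).mp hz'))
  · by_contra hz'
    exact hW.compl.convex hz' hb ((mem_halfspace_iff h).mp hz) ha

theorem dist_le_one_of_subsingleton (h : {W | IsHalfspace G W ∧ x ∈ W ∧ y ∉ W}.Subsingleton) :
    G.dist x y ≤ 1 := by
  rcases eq_or_ne x y with rfl | hne
  · simp
  obtain ⟨x', hadj, hx'⟩ := exists_adj_geodBtw (connected (G := G)) hne
  have hy : y ∉ halfspace G x x' := (notMem_halfspace_iff hadj).mpr hx'.symm
  obtain rfl : x' = y := by
    refine eq_of_forall_halfspace (G := G) fun W hW hx'W => ?_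
    by_contra hyW
    have hxW : x ∈ W := by
      by_contra hxW
      exact hW.compl.convex hxW hyW hx' hx'W
    have hW_eq : W = halfspace G x x' :=
      h ⟨hW, hxW, hyW⟩ ⟨isHalfspace_halfspace hadj, left_mem_halfspace hadj, hy⟩
    exact right_notMem_halfspace (hW_eq ▸ hx'W)
  exact (SimpleGraph.dist_eq_one_iff_adj.mpr hadj).le

end IsMedianGraph

/-! ## Cubes -/

/-- A map from the vertices of a cube to a graph that preserves betweenness. -/
def PreservesBtw {V : Type*} (G : SimpleGraph V) {n : ℕ} (g : (Fin n → Bool) → V) : Prop :=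
  ∀ a b c, (∀ i, b i = a i ∨ b i = c i) → GeodBtw G (g a) (g b) (g c)

/-- The length of the image of the edge in direction `i` at the vertex `(false, …, false)`. If `g`
preserves betweenness, then the images of all edges in direction `i` have this length. -/
noncomputable def edgeLength {V : Type*} (G : SimpleGraph V) {n : ℕ} (g : (Fin n → Bool) → V)
    (i : Fin n) : ℕ :=
  G.dist (g fun _ => false) (g (Function.update (fun _ => false) i true))

theorem hammingDist_eq_sum {n : ℕ} (a b : Fin n → Bool) :
    hammingDist a b = ∑ i, if a i ≠ b i then 1 else 0 := by
  rw [hammingDist, Finset.card_filter]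

section

variable {V : Type*} {G : SimpleGraph V} {n : ℕ} {g : (Fin n → Bool) → V}

theorem IsGraphCube.preservesBtw (hg : IsGraphCube G g) : PreservesBtw G g := by
  intro x y z h
  unfold GeodBtw
  rw [hg, hg, hg, hammingDist_eq_sum, hammingDist_eq_sum, hammingDist_eq_sum,
    ← Finset.sum_add_distrib]
  refine Finset.sum_congr rfl fun i _ => ?_
  rcases h i with h | h <;> simp [h]

theorem isGraphCube_edge {u v : V} (h : G.Adj u v) :
    IsGraphCube G fun a : Fin 1 → Bool => if a 0 then v else u := by
  intro a b
  cases ha : a 0 <;> cases hb : b 0 <;>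
    simp [hammingDist, Finset.filter_singleton, ha, hb, SimpleGraph.dist_eq_one_iff_adj, h, h.symm]

theorem GeodBtw.dist_eq_dist_of_rectangle {x y z w : V} (hxyz : GeodBtw G x y z)
    (hyzw : GeodBtw G y z w) (hzwx : GeodBtw G z w x) (hwxy : GeodBtw G w x y) :
    G.dist w z = G.dist x y := by
  have h_xz := G.dist_comm (u := x) (v := z)
  have h_yw := G.dist_comm (u := y) (v := w)
  have h_xw := G.dist_comm (u := x) (v := w)
  have h_zw := G.dist_comm (u := z) (v := w)
  unfold GeodBtw at *
  omega

namespace PreservesBtw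

theorem dist_update_true (hg : PreservesBtw G g) {a : Fin n → Bool} {i : Fin n}
    (ha : a i = false) : G.dist (g a) (g (Function.update a i true)) = edgeLength G g i := by
  refine GeodBtw.dist_eq_dist_of_rectangle (hg _ _ _ fun j => ?_) (hg _ _ _ fun j => ?_)
    (hg _ _ _ fun j => ?_) (hg _ _ _ fun j => ?_) <;>
  by_cases h : j = i <;> simp [h, ha]

theorem dist_update (hg : PreservesBtw G g) (b : Fin n → Bool) (i : Fin n) (β : Bool) :
    G.dist (g (Function.update b i β)) (g b) = if β ≠ b i then edgeLength G g i else 0 := by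
  cases hb : b i <;> cases β
  · simp [← hb]
  · simp [G.dist_comm, hg.dist_update_true hb]
  · have h := hg.dist_update_true (a := Function.update b i false) (i := i) (by simp)
    simpa [← hb] using h
  · simp [← hb]

theorem dist_eq_sum (hg : PreservesBtw G g) (a b : Fin n → Bool) :
    G.dist (g a) (g b) = ∑ i, if a i ≠ b i then edgeLength G g i else 0 := by
  suffices H : ∀ (D : Finset (Fin n)) (b : Fin n → Bool), (∀ i ∉ D, a i = b i) →
      G.dist (g a) (g b) = ∑ i ∈ D, if a i ≠ b i then edgeLength G g i else 0 from
    H Finset.univ b (by simp)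
  intro D
  induction D using Finset.induction_on with
  | empty =>
    intro b hb
    obtain rfl : a = b := funext fun i => hb i (by simp)
    simp
  | insert i D hi ih =>
    intro b hb
    have h_btw := hg a (Function.update b i (a i)) b fun j => by
      by_cases h : j = i <;> [left; right] <;> simp [h]
    have h_ih := ih (Function.update b i (a i)) fun j hj => by
      by_cases h : j = i
      · simp [h]
      · simpa [h] using hb j (by simp [h, hj])
    rw [Finset.sum_insert hi, h_btw, h_ih, hg.dist_update, add_comm]
    congr 1
    refine Finset.sum_congr rfl fun j hj => ?_
    simp [ne_of_mem_of_not_mem hj hi]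

theorem isGraphCube (hg : PreservesBtw G g) (h : ∀ i, edgeLength G g i = 1) : IsGraphCube G g := by
  intro a b
  rw [hg.dist_eq_sum, hammingDist_eq_sum]
  simp only [h]

/-- The directions of length zero are collapsed, so that `g` factors through a coordinate
projection onto the other ones. -/
theorem exists_factor (hG : G.Connected) (hg : PreservesBtw G g) (h : ∀ i, edgeLength G g i ≤ 1) :
    ∃ (m : ℕ) (ι : Fin m → Fin n) (c : (Fin m → Bool) → V), Function.Injective ι ∧
      IsGraphCube G c ∧ ∀ a, g a = c (a ∘ ι) := by
  classical
  let J : Finset (Fin n) := Finset.univ.filter fun i => edgeLength G g i = 1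
  let ι : Fin J.card → Fin n := J.orderEmbOfFin rfl
  have hι : Function.Injective ι := (J.orderEmbOfFin rfl).injective
  have hι_range : ∀ i, i ∈ Set.range ι ↔ edgeLength G g i = 1 := fun i => by
    simp [ι, Finset.range_orderEmbOfFin J rfl, J]
  have h_one : ∀ k, edgeLength G g (ι k) = 1 := fun k => (hι_range _).mp ⟨k, rfl⟩
  have h_zero : ∀ i ∉ Set.range ι, edgeLength G g i = 0 := fun i hi =>
    Nat.lt_one_iff.mp ((h i).lt_of_ne (mt (hι_range i).mpr hi))
  refine ⟨J.card, ι, fun b => g (Function.extend ι b fun _ => false), hι, fun b b' => ?_,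
    fun a => ?_⟩
  · rw [hg.dist_eq_sum, hammingDist_eq_sum]
    refine (Fintype.sum_of_injective ι hι _ _ (fun i hi => ?_) fun k => ?_).symm
    · simp [h_zero i hi]
    · simp [hι.extend_apply, h_one]
  · refine hG.dist_eq_zero_iff.mp ?_
    rw [hg.dist_eq_sum]
    refine Finset.sum_eq_zero fun i _ => ?_
    by_cases hi : i ∈ Set.range ι
    · obtain ⟨k, rfl⟩ := hi
      simp [hι.extend_apply]
    · simp [h_zero i hi]

end PreservesBtw

end

/-- `v` is the vertex opposite to `y` in a cube spanned by the set `T` of neighbours of `y`: the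
halfspaces that separate it from `y` are those that separate an element of `T` from `y`. -/
def IsOppositeCorner {V : Type*} (G : SimpleGraph V) (y : V) (T : Set V) (v : V) : Prop :=
  ∀ W, IsHalfspace G W → y ∉ W → (v ∈ W ↔ ∃ u ∈ T, W = halfspace G u y)

theorem isOppositeCorner_empty {V : Type*} {G : SimpleGraph V} {y : V} :
    IsOppositeCorner G y ∅ y :=
  fun W _ hy => by simpa using hy

namespace IsMedianGraph

variable {V : Type*} {G : SimpleGraph V} [IsMedianGraph G] {y u u' v v' w : V}

theorem eq_of_halfspace_eq (hu : G.Adj y u) (hu' : G.Adj y u')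
    (h : halfspace G u y = halfspace G u' y) : u = u' := by
  have h_mem := left_mem_halfspace hu.symm
  have h_mem' := left_mem_halfspace hu'.symm
  rw [h, mem_halfspace_iff hu'.symm] at h_mem
  rw [← h, mem_halfspace_iff hu.symm] at h_mem'
  exact h_mem'.symm.antisymm connected h_mem.symm

theorem mem_iff_eq_halfspace (hu : G.Adj y u) {W : Set V} (hW : IsHalfspace G W) (hy : y ∉ W) :
    u ∈ W ↔ W = halfspace G u y :=
  ⟨fun h => hW.eq_halfspace hu.symm h hy, fun h => h ▸ left_mem_halfspace hu.symm⟩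

theorem isOppositeCorner_singleton (hu : G.Adj y u) : IsOppositeCorner G y {u} u :=
  fun W hW hy => by simpa using mem_iff_eq_halfspace hu hW hy

end IsMedianGraph

namespace IsOppositeCorner

open IsMedianGraph

variable {V : Type*} {G : SimpleGraph V} [IsMedianGraph G] {y u v v' w : V} {T : Set V}

theorem insert (h : IsOppositeCorner G y T v) (hT : ∀ u ∈ T, w ∈ halfspace G u y)
    (hu : G.Adj y u) (hw : w ∈ halfspace G u y) :
    IsOppositeCorner G y (insert u T) (med G v u w) := by
  intro W hW hy
  have hwW : W = halfspace G u y → w ∈ W := fun h => h ▸ hw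
  rw [hW.med_mem_iff, h W hW hy, mem_iff_eq_halfspace hu hW hy]
  simp only [Set.mem_insert_iff, exists_eq_or_imp]
  grind

theorem geodBtw {T₁ T₂ T₃ : Set V} {v₁ v₂ v₃ : V} (h₁ : IsOppositeCorner G y T₁ v₁)
    (h₂ : IsOppositeCorner G y T₂ v₂) (h₃ : IsOppositeCorner G y T₃ v₃)
    (hT₁ : ∀ u ∈ T₁, G.Adj y u) (hT₃ : ∀ u ∈ T₃, G.Adj y u) (h_inter : T₁ ∩ T₃ ⊆ T₂)
    (h_union : T₂ ⊆ T₁ ∪ T₃) : GeodBtw G v₁ v₂ v₃ := by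
  refine geodBtw_of_forall_halfspace fun W hW hv₁ hv₃ => ?_
  by_cases hy : y ∈ W
  · have hy' : y ∉ Wᶜ := not_not.mpr hy
    by_contra hv₂
    obtain ⟨u, hu, hWu⟩ := (h₂ Wᶜ hW.compl hy').mp hv₂
    rcases h_union hu with hu | hu
    · exact (h₁ Wᶜ hW.compl hy').mpr ⟨u, hu, hWu⟩ hv₁
    · exact (h₃ Wᶜ hW.compl hy').mpr ⟨u, hu, hWu⟩ hv₃
  · obtain ⟨u, hu, hWu⟩ := (h₁ W hW hy).mp hv₁
    obtain ⟨u', hu', hWu'⟩ := (h₃ W hW hy).mp hv₃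
    obtain rfl := eq_of_halfspace_eq (hT₁ u hu) (hT₃ u' hu') (hWu.symm.trans hWu')
    exact (h₂ W hW hy).mpr ⟨u, h_inter ⟨hu, hu'⟩, hWu⟩

theorem unique (h : IsOppositeCorner G y T v) (h' : IsOppositeCorner G y T v') : v = v' := by
  refine eq_of_forall_halfspace (G := G) fun W hW hv => ?_
  by_cases hy : y ∈ W
  · by_contra hv'
    have hy' : y ∉ Wᶜ := not_not.mpr hy
    exact (h Wᶜ hW.compl hy').mpr ((h' Wᶜ hW.compl hy').mp hv') hv
  · exact (h' W hW hy).mpr ((h W hW hy).mp hv)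

end IsOppositeCorner

namespace IsMedianGraph

variable {V : Type*} {G : SimpleGraph V} [IsMedianGraph G] {y w : V}

theorem exists_isOppositeCorner {T : Set V} (hT_fin : T.Finite)
    (hT : ∀ u ∈ T, G.Adj y u ∧ w ∈ halfspace G u y) : ∃ v, IsOppositeCorner G y T v := by
  induction T, hT_fin using Set.Finite.induction_on with
  | empty => exact ⟨y, isOppositeCorner_empty⟩
  | insert _ _ ih =>
    obtain ⟨v, hv⟩ := ih fun u hu => hT u (Set.mem_insert_of_mem _ hu)
    obtain ⟨hadj, hw⟩ := hT _ (Set.mem_insert _ _)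
    exact ⟨_, hv.insert (fun u hu => (hT u (Set.mem_insert_of_mem _ hu)).2) hadj hw⟩

theorem exists_isGraphCube_of_adj {k : ℕ} {u : Fin k → V} (hu_inj : Function.Injective u)
    (hu : ∀ i, G.Adj y (u i) ∧ w ∈ halfspace G (u i) y) :
    ∃ c : (Fin k → Bool) → V, IsGraphCube G c := by
  have h_exists : ∀ a : Fin k → Bool, ∃ v, IsOppositeCorner G y (u '' {i | a i = true}) v :=
    fun a => exists_isOppositeCorner (w := w) (Set.toFinite _)
      (Set.forall_mem_image.mpr fun i _ => hu i)
  choose c hc using h_exists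
  have h_adj : ∀ a : Fin k → Bool, ∀ v ∈ u '' {i | a i = true}, G.Adj y v :=
    fun a => Set.forall_mem_image.mpr fun i _ => (hu i).1
  have hc_btw : PreservesBtw G c := by
    intro a b d h
    refine (hc a).geodBtw (hc b) (hc d) (h_adj a) (h_adj d) ?_ ?_
    · rw [← Set.image_inter hu_inj]
      refine Set.image_mono fun i hi => ?_
      rcases h i with h | h
      · exact h.trans hi.1
      · exact h.trans hi.2
    · rw [← Set.image_union]
      refine Set.image_mono fun i hi => ?_
      exact (h i).imp (fun h => h.symm.trans hi) fun h => h.symm.trans hi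
  have hc_bot : c (fun _ => false) = y :=
    (hc _).unique (by simpa using isOppositeCorner_empty)
  have hc_single : ∀ i, c (Function.update (fun _ => false) i true) = u i := fun i => by
    refine (hc _).unique ?_
    have h_support : {j | Function.update (fun _ => false) i true j = true} = {i} := by
      ext j
      by_cases h : j = i <;> simp [h]
    rw [h_support, Set.image_singleton]
    exact isOppositeCorner_singleton (hu i).1
  refine ⟨c, hc_btw.isGraphCube fun i => ?_⟩
  rw [edgeLength, hc_bot, hc_single, SimpleGraph.dist_eq_one_iff_adj]
  exact (hu i).1

end IsMedianGraph

/-! ## The median retraction onto the geodesics between two ends -/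

/-- `p` is the limit of the filter `l` on the vertices of `G`: most vertices of `l` are reached
from any given vertex along a geodesic through `p`. -/
def IsLimitVertex {V : Type*} (G : SimpleGraph V) (l : Filter V) (p : V) : Prop :=
  ∀ u, ∀ᶠ v in l, GeodBtw G u p v

theorem IsLimitVertex.dist_le {V : Type*} {G : SimpleGraph V} {l : Filter V} [l.NeBot] {p x : V}
    {R : ℕ} (hp : IsLimitVertex G l p) (hR : ∀ᶠ v in l, G.dist x v ≤ R) : G.dist x p ≤ R := by
  obtain ⟨v, hv, hv'⟩ := ((hp x).and hR).exists
  unfold GeodBtw at hv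
  omega

/-- `φ` sends every vertex `x` to its median with two ends of `G`, which are given by ultrafilters
`𝒜` and `ℬ`. As a median of vertices is determined by the halfspaces it lies in, this can be
expressed by majority of the three memberships. -/
def IsEndRetraction {V : Type*} (G : SimpleGraph V) (𝒜 ℬ : Ultrafilter V) (φ : V → V) : Prop :=
  ∀ x W, IsHalfspace G W →
    (φ x ∈ W ↔ (W ∈ 𝒜 ∧ x ∈ W) ∨ (x ∈ W ∧ W ∈ ℬ) ∨ (W ∈ 𝒜 ∧ W ∈ ℬ))

namespace IsMedianGraph

open Filter

variable {V : Type*} {G : SimpleGraph V} [IsMedianGraph G]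

theorem finite_setOf_adj_eventually_mem_halfspace (hdim : CubeComplex.FiniteDimensional G)
    (l : Filter V) [l.NeBot] (y : V) :
    {u | G.Adj y u ∧ ∀ᶠ w in l, w ∈ halfspace G u y}.Finite := by
  obtain ⟨N, hN⟩ := hdim
  by_contra h_inf
  let u := Set.Infinite.natEmbedding _ h_inf
  obtain ⟨w, hw⟩ : ∃ w, ∀ i : Fin (N + 1), w ∈ halfspace G (u i) y :=
    (eventually_all.mpr fun i : Fin (N + 1) => (u i).2.2).exists
  obtain ⟨c, hc⟩ := exists_isGraphCube_of_adj (y := y) (w := w) (u := fun i : Fin (N + 1) => u i)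
    (fun i j hij => Fin.ext (u.injective (Subtype.ext hij))) fun i => ⟨(u i).2.1, hw i⟩
  exact absurd (hN _ c hc) (by omega)

theorem exists_adj_eventually_geodBtw (hdim : CubeComplex.FiniteDimensional G)
    {𝒱 : Ultrafilter V} {u w : V} (h : ¬∀ᶠ v in 𝒱, GeodBtw G u w v) :
    ∃ w', G.Adj w w' ∧ ∀ᶠ v in 𝒱, GeodBtw G w w' v := by
  have hG : G.Connected := connected
  have h_step : ∀ᶠ v in 𝒱, ∃ w' ∈ {w' | G.Adj w w' ∧ ∀ᶠ u' in pure u, u' ∈ halfspace G w' w},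
      GeodBtw G w w' v := by
    filter_upwards [Ultrafilter.eventually_not.mpr h] with v hv
    have hne : w ≠ med G u w v := fun he => hv (he ▸ geodBtw_med₁₃ (G := G) u w v)
    obtain ⟨w', hadj, hw'⟩ := exists_adj_geodBtw hG hne
    exact ⟨w', ⟨hadj, (mem_halfspace_iff hadj.symm).mpr
      ((geodBtw_med₁₂ u w v).symm.trans_left hG hw').symm⟩,
      (geodBtw_med₂₃ u w v).trans_left hG hw'⟩
  rw [Ultrafilter.eventually_exists_mem_iff
    (finite_setOf_adj_eventually_mem_halfspace hdim (pure u) w)] at h_step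
  obtain ⟨w', ⟨hadj, -⟩, hw'⟩ := h_step
  exact ⟨w', hadj, hw'⟩

theorem exists_isLimitVertex (hdim : CubeComplex.FiniteDimensional G) {𝒱 : Ultrafilter V}
    {o : V} {R : ℕ} (hR : ∀ᶠ v in 𝒱, G.dist o v ≤ R) : ∃ p, IsLimitVertex G 𝒱 p := by
  classical
  have h_bound : ∃ k, ∃ w, ∀ᶠ v in 𝒱, G.dist w v ≤ k := ⟨R, o, hR⟩
  obtain ⟨w, hw⟩ := Nat.find_spec h_bound
  refine ⟨w, fun u => ?_⟩
  by_contra h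
  obtain ⟨w', hadj, hw'⟩ := exists_adj_eventually_geodBtw hdim h
  have h_closer : ∀ᶠ v in 𝒱, G.dist w' v + 1 ≤ Nat.find h_bound := by
    filter_upwards [hw, hw'] with v hv hv'
    have := SimpleGraph.dist_eq_one_iff_adj.mpr hadj
    unfold GeodBtw at hv'
    omega
  obtain ⟨v, hv⟩ := h_closer.exists
  exact Nat.find_min h_bound (m := Nat.find h_bound - 1) (by omega)
    ⟨w', h_closer.mono fun v hv => by omega⟩

theorem _root_.IsLimitVertex.mem_of_mem {l : Filter V} [l.NeBot] {p : V} {W : Set V}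
    (hp : IsLimitVertex G l p) (hW : IsHalfspace G W) (h : W ∈ l) : p ∈ W := by
  obtain ⟨a, b, hab, rfl⟩ := id hW
  obtain ⟨v, hv, hvW⟩ := ((hp a).and h).exists
  exact hW.convex (left_mem_halfspace hab) hvW hv

theorem _root_.IsLimitVertex.mem_iff {𝒱 : Ultrafilter V} {p : V} {W : Set V}
    (hp : IsLimitVertex G 𝒱 p) (hW : IsHalfspace G W) : p ∈ W ↔ W ∈ 𝒱 := by
  refine ⟨fun h => ?_, hp.mem_of_mem hW⟩
  by_contra hn
  exact hp.mem_of_mem hW.compl (Ultrafilter.compl_mem_iff_notMem.mpr hn) h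

theorem exists_isEndRetraction (hdim : CubeComplex.FiniteDimensional G) {𝒜 ℬ : Ultrafilter V}
    (h : ∀ x, ∃ R : ℕ, ∀ᶠ a in 𝒜, ∀ᶠ b in ℬ, G.dist x (med G a x b) ≤ R) :
    ∃ φ, IsEndRetraction G 𝒜 ℬ φ ∧ ∀ x (R : ℕ),
      (∀ᶠ a in 𝒜, ∀ᶠ b in ℬ, G.dist x (med G a x b) ≤ R) → G.dist x (φ x) ≤ R := by
  let 𝒱 (x : V) : Ultrafilter V := 𝒜.bind fun a => ℬ.map fun b => med G a x b
  have h_eventually : ∀ x (P : V → Prop),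
      (∀ᶠ v in 𝒱 x, P v) ↔ ∀ᶠ a in 𝒜, ∀ᶠ b in ℬ, P (med G a x b) := fun _ _ => Iff.rfl
  have h_limit : ∀ x, ∃ p, IsLimitVertex G (𝒱 x) p := fun x =>
    (h x).elim fun _ hR => exists_isLimitVertex hdim ((h_eventually x _).mpr hR)
  choose φ hφ using h_limit
  refine ⟨φ, fun x W hW => ?_, fun x R hR => (hφ x).dist_le ((h_eventually x _).mpr hR)⟩
  rw [(hφ x).mem_iff hW]
  refine (h_eventually x (· ∈ W)).trans ?_
  simp only [hW.med_mem_iff, Ultrafilter.eventually_or, eventually_and, eventually_const]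
  rfl

end IsMedianGraph

namespace IsEndRetraction

open Filter IsMedianGraph

variable {V : Type*} {G : SimpleGraph V} {𝒜 ℬ : Ultrafilter V} {φ : V → V} {x y z : V}

theorem mem_or_mem (hφ : IsEndRetraction G 𝒜 ℬ φ) {W : Set V} (hW : IsHalfspace G W)
    (h : φ x ∈ W) : W ∈ 𝒜 ∨ W ∈ ℬ := by
  rw [hφ _ W hW] at h
  tauto

variable [IsMedianGraph G]

theorem geodBtw (hφ : IsEndRetraction G 𝒜 ℬ φ) (h : GeodBtw G x y z) :
    GeodBtw G (φ x) (φ y) (φ z) := by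
  refine geodBtw_of_forall_halfspace fun W hW hx hz => ?_
  have h_convex : x ∈ W → z ∈ W → y ∈ W := fun hx hz => hW.convex hx hz h
  rw [hφ _ W hW] at hx hz ⊢
  tauto

theorem dist_le_one (hφ : IsEndRetraction G 𝒜 ℬ φ) (h : G.Adj x y) :
    G.dist (φ x) (φ y) ≤ 1 := by
  have h_unique : ∀ W, IsHalfspace G W → φ x ∈ W → φ y ∉ W → W = halfspace G x y := by
    intro W hW hx hy
    rw [hφ _ W hW] at hx hy
    exact hW.eq_halfspace h (by tauto) (by tauto)
  exact dist_le_one_of_subsingleton fun W ⟨hW, hx, hy⟩ W' ⟨hW', hx', hy'⟩ =>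
    (h_unique W hW hx hy).trans (h_unique W' hW' hx' hy').symm

theorem apply_eq_self_iff (hφ : IsEndRetraction G 𝒜 ℬ φ) :
    φ y = y ↔ ∀ W, IsHalfspace G W → y ∈ W → W ∈ 𝒜 ∨ W ∈ ℬ := by
  refine ⟨fun h W hW hy => hφ.mem_or_mem hW (h.symm ▸ hy),
    fun h => (eq_of_forall_halfspace (G := G) fun W hW hy => ?_).symm⟩
  rw [hφ _ W hW]
  have := h W hW hy
  tauto

theorem apply_apply (hφ : IsEndRetraction G 𝒜 ℬ φ) (x : V) : φ (φ x) = φ x :=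
  hφ.apply_eq_self_iff.mpr fun _ hW h => hφ.mem_or_mem hW h

theorem apply_eq_self_of_geodBtw (hφ : IsEndRetraction G 𝒜 ℬ φ) (hx : φ x = x) (hz : φ z = z)
    (h : GeodBtw G x y z) : φ y = y := by
  rw [hφ.apply_eq_self_iff] at *
  intro W hW hy
  by_contra hW'
  exact hW.compl.convex (mt (hx W hW) hW') (mt (hz W hW) hW') h hy

theorem finite_setOf_adj (hφ : IsEndRetraction G 𝒜 ℬ φ)
    (hdim : CubeComplex.FiniteDimensional G) (y : V) : {u | G.Adj y u ∧ φ u = u}.Finite := by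
  refine ((finite_setOf_adj_eventually_mem_halfspace hdim 𝒜 y).union
    (finite_setOf_adj_eventually_mem_halfspace hdim ℬ y)).subset ?_
  rintro u ⟨hadj, hu⟩
  exact (hφ.apply_eq_self_iff.mp hu _ (isHalfspace_halfspace hadj.symm)
    (left_mem_halfspace hadj.symm)).imp (⟨hadj, ·⟩) (⟨hadj, ·⟩)

theorem finite_setOf_dist_le (hφ : IsEndRetraction G 𝒜 ℬ φ)
    (hdim : CubeComplex.FiniteDimensional G) {o : V} (ho : φ o = o) (R : ℕ) :
    {y | φ y = y ∧ G.dist o y ≤ R}.Finite := by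
  have hG : G.Connected := connected
  induction R with
  | zero =>
    refine (Set.finite_singleton o).subset ?_
    rintro y ⟨-, hy⟩
    exact (hG.dist_eq_zero_iff.mp (Nat.le_zero.mp hy)).symm
  | succ R ih =>
    refine ((ih.biUnion fun z _ => hφ.finite_setOf_adj hdim z).insert o).subset ?_
    rintro y ⟨hy, h_dist⟩
    rcases eq_or_ne y o with rfl | hne
    · exact Set.mem_insert _ _
    obtain ⟨z, hadj, hz⟩ := exists_adj_geodBtw hG hne
    refine Or.inr (Set.mem_biUnion (x := z) ⟨hφ.apply_eq_self_of_geodBtw hy ho hz, ?_⟩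
      ⟨hadj.symm, hy⟩)
    have h_edge := SimpleGraph.dist_eq_one_iff_adj.mpr hadj
    unfold GeodBtw at hz
    rw [G.dist_comm, G.dist_comm (u := z)] at hz
    omega

end IsEndRetraction

/-! ## Cubical maps of cube complexes -/

/-- A map between the vertices of `G` that maps cubes onto cubes of possibly smaller dimension: it
preserves betweenness and does not stretch edges. -/
structure IsCubical {V : Type*} (G : SimpleGraph V) (φ : V → V) : Prop where
  geodBtw : ∀ {x y z}, GeodBtw G x y z → GeodBtw G (φ x) (φ y) (φ z)
  dist_le_one : ∀ {x y}, G.Adj x y → G.dist (φ x) (φ y) ≤ 1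

theorem IsEndRetraction.isCubical {V : Type*} {G : SimpleGraph V} [IsMedianGraph G]
    {𝒜 ℬ : Ultrafilter V} {φ : V → V} (hφ : IsEndRetraction G 𝒜 ℬ φ) : IsCubical G φ :=
  ⟨hφ.geodBtw, hφ.dist_le_one⟩

theorem IsCubical.exists_isGraphCube {V : Type*} {G : SimpleGraph V} {φ : V → V}
    (hG : G.Connected) (hφ : IsCubical G φ) {n : ℕ} {c : (Fin n → Bool) → V}
    (hc : IsGraphCube G c) :
    ∃ (m : ℕ) (ι : Fin m → Fin n) (c' : (Fin m → Bool) → V), Function.Injective ι ∧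
      IsGraphCube G c' ∧ ∀ a, φ (c a) = c' (a ∘ ι) := by
  have h_btw : PreservesBtw G (φ ∘ c) := fun x y z h => hφ.geodBtw (hc.preservesBtw x y z h)
  refine h_btw.exists_factor hG fun i => hφ.dist_le_one ?_
  rw [← SimpleGraph.dist_eq_one_iff_adj, hc, hammingDist_eq_sum,
    Finset.sum_eq_single i (fun j _ hj => by simp [hj]) (by simp)]
  simp

namespace CubeComplex

section Weights

variable {V : Type*} {m n : ℕ} {ι : Fin m → Fin n}

/-- The weight of the corner `a` in the multilinear interpolation at `s` of the corners of the unit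
cube. -/
noncomputable def weight (s : EuclideanSpace ℝ (Fin n)) (a : Fin n → Bool) : ℝ :=
  ∏ i, if a i then s i else 1 - s i

theorem cubePoint_eq_sum_weight (c : (Fin n → Bool) → V) (s : EuclideanSpace ℝ (Fin n)) :
    cubePoint c s = ∑ a, Finsupp.single (c a) (weight s a) := rfl

/-- The coordinates of `s` selected by `ι`. -/
noncomputable def reindex (ι : Fin m → Fin n) (s : EuclideanSpace ℝ (Fin n)) :
    EuclideanSpace ℝ (Fin m) :=
  WithLp.toLp 2 fun k => s (ι k)

theorem reindex_mem_unitCube (ι : Fin m → Fin n) {s : EuclideanSpace ℝ (Fin n)}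
    (hs : s ∈ unitCube n) : reindex ι s ∈ unitCube m :=
  fun k => hs (ι k)

theorem dist_reindex_le (hι : Function.Injective ι) (s t : EuclideanSpace ℝ (Fin n)) :
    dist (reindex ι s) (reindex ι t) ≤ dist s t := by
  rw [EuclideanSpace.dist_eq, EuclideanSpace.dist_eq]
  refine Real.sqrt_le_sqrt ?_
  calc ∑ k, dist (s (ι k)) (t (ι k)) ^ 2
      = ∑ i ∈ Finset.univ.map ⟨ι, hι⟩, dist (s i) (t i) ^ 2 := by simp
    _ ≤ ∑ i, dist (s i) (t i) ^ 2 :=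
      Finset.sum_le_univ_sum_of_nonneg fun i => by positivity

theorem sum_weight_fiber (hι : Function.Injective ι) (s : EuclideanSpace ℝ (Fin n))
    (b : Fin m → Bool) : ∑ a with a ∘ ι = b, weight s a = weight (reindex ι s) b := by
  classical
  let t : Fin n → Finset Bool := fun i => {β | ∀ k, ι k = i → β = b k}
  have h_fiber : ({a | a ∘ ι = b} : Finset (Fin n → Bool)) = Fintype.piFinset t := by
    ext a
    simp only [Finset.mem_filter, Finset.mem_univ, true_and, Fintype.mem_piFinset, t,
      funext_iff, Function.comp_apply]
    exact ⟨fun h i k hk => hk ▸ h k, fun h k => h _ k rfl⟩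
  have h_range : ∀ k, t (ι k) = {b k} := fun k => by
    ext β
    simp only [t, Finset.mem_filter, Finset.mem_univ, true_and, Finset.mem_singleton]
    exact ⟨fun h => h k rfl, fun h l hl => by rw [h, hι hl]⟩
  have h_compl : ∀ i ∉ Set.range ι, t i = Finset.univ := fun i hi =>
    Finset.filter_true_of_mem fun β _ k hk => absurd ⟨k, hk⟩ hi
  simp only [h_fiber, weight]
  rw [← Finset.prod_univ_sum t fun i β => if β = true then s i else 1 - s i]
  refine (Fintype.prod_of_injective ι hι _ _ (fun i hi => ?_) fun k => ?_).symm
  · simp [h_compl i hi]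
  · simp [h_range, reindex]

theorem sum_weight (s : EuclideanSpace ℝ (Fin n)) : ∑ a, weight s a = 1 := by
  have h := sum_weight_fiber (ι := (Fin.elim0 : Fin 0 → Fin n)) (fun i => i.elim0) s ![]
  rw [Finset.filter_true_of_mem fun a _ => Subsingleton.elim _ _] at h
  rw [h]
  simp [weight]

theorem mapDomain_cubePoint (hι : Function.Injective ι) {φ : V → V} {c : (Fin n → Bool) → V}
    {c' : (Fin m → Bool) → V} (h : ∀ a, φ (c a) = c' (a ∘ ι)) (s : EuclideanSpace ℝ (Fin n)) :
    (cubePoint c s).mapDomain φ = cubePoint c' (reindex ι s) := by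
  classical
  rw [cubePoint_eq_sum_weight, cubePoint_eq_sum_weight, Finsupp.mapDomain_finsetSum]
  simp only [Finsupp.mapDomain_single, h]
  rw [← Finset.sum_fiberwise (s := Finset.univ) (g := fun a : Fin n → Bool => a ∘ ι)]
  refine Finset.sum_congr rfl fun b _ => ?_
  rw [← sum_weight_fiber hι, Finsupp.single_finsetSum]
  refine Finset.sum_congr rfl fun a ha => ?_
  rw [(Finset.mem_filter.mp ha).2]

end Weights

variable {V : Type*} {G : SimpleGraph V} [IsMedianGraph G] {φ : V → V}

theorem PathOfLength.dist_le {x y : CubeComplex G} {l : ℝ} (h : PathOfLength G x y l) :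
    dist x y ≤ l :=
  csInf_le (bddBelow_pathLengths x y) h

theorem InCubeAtDist.dist_le {x y : CubeComplex G} {r : ℝ} (h : InCubeAtDist G x y r) :
    dist x y ≤ r :=
  h.path.dist_le

theorem exists_pathOfLength_lt (x y : CubeComplex G) {ε : ℝ} (hε : 0 < ε) :
    ∃ l, PathOfLength G x y l ∧ l < dist x y + ε :=
  exists_lt_of_csInf_lt (exists_path IsMedianGraph.connected x y)
    (lt_add_of_pos_right (dist x y) hε)

open scoped NNReal Pointwise in
theorem lipschitzWith_of_inCubeAtDist {M : Type*} [PseudoMetricSpace M] {f : CubeComplex G → M}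
    {K : ℝ≥0} (h : ∀ x y r, InCubeAtDist G x y r → dist (f x) (f y) ≤ K * r) :
    LipschitzWith K f := by
  have h_path : ∀ {x y l}, PathOfLength G x y l → dist (f x) (f y) ≤ K * l := by
    intro x y l hl
    induction hl with
    | refl => simp
    | @snoc y z l r _ hr ih =>
      calc dist (f x) (f z) ≤ dist (f x) (f y) + dist (f y) (f z) := dist_triangle _ _ _
        _ ≤ K * l + K * r := add_le_add ih (h _ _ _ hr)
        _ = K * (l + r) := by ring
  refine LipschitzWith.of_dist_le_mul fun x y => ?_
  change _ ≤ (K : ℝ) * sInf {l | PathOfLength G x y l}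
  rw [← smul_eq_mul, ← Real.sInf_smul_of_nonneg K.coe_nonneg]
  refine le_csInf (Set.Nonempty.smul_set (exists_path IsMedianGraph.connected x y)) ?_
  rintro _ ⟨l, hl, rfl⟩
  exact h_path hl

/-- The extension of a cubical map from the vertices to the cube complex. -/
noncomputable def map (hφ : IsCubical G φ) (x : CubeComplex G) : CubeComplex G :=
  ⟨x.1.mapDomain φ, by
    obtain ⟨n, c, s, hc, hs, hx⟩ := x.2
    obtain ⟨m, ι, c', hι, hc', h⟩ := hφ.exists_isGraphCube IsMedianGraph.connected hc
    exact ⟨m, c', reindex ι s, hc', reindex_mem_unitCube ι hs, by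
      rw [hx, mapDomain_cubePoint hι h]⟩⟩

theorem map_vertex (hφ : IsCubical G φ) (v : V) : map hφ (vertex G v) = vertex G (φ v) :=
  Subtype.ext (by simp [map, vertex])

theorem map_map (hφ : IsCubical G φ) (h_idem : ∀ v, φ (φ v) = φ v) (x : CubeComplex G) :
    map hφ (map hφ x) = map hφ x :=
  Subtype.ext (by simp [map, ← Finsupp.mapDomain_comp, Function.comp_def, h_idem])

theorem lipschitzWith_map (hφ : IsCubical G φ) : LipschitzWith 1 (map hφ) := by
  refine lipschitzWith_of_inCubeAtDist ?_
  rintro x y r ⟨n, c, s, t, hc, hs, ht, hx, hy, rfl⟩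
  obtain ⟨m, ι, c', hι, hc', h⟩ := hφ.exists_isGraphCube IsMedianGraph.connected hc
  have h_image : InCubeAtDist G (map hφ x) (map hφ y) (dist (reindex ι s) (reindex ι t)) := by
    refine ⟨m, c', _, _, hc', reindex_mem_unitCube ι hs, reindex_mem_unitCube ι ht, ?_, ?_, rfl⟩
    · rw [← mapDomain_cubePoint hι h, ← hx]; rfl
    · rw [← mapDomain_cubePoint hι h, ← hy]; rfl
  simpa using h_image.dist_le.trans (dist_reindex_le hι s t)

/-- The point of the complex with coordinates `s` in the cube `c`. -/
noncomputable def ofCube {n : ℕ} {c : (Fin n → Bool) → V} (hc : IsGraphCube G c)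
    (s : unitCube n) : CubeComplex G :=
  ⟨cubePoint c s, n, c, s, hc, s.2, rfl⟩

omit [IsMedianGraph G] in
theorem exists_eq_ofCube (x : CubeComplex G) :
    ∃ (n : ℕ) (c : (Fin n → Bool) → V) (hc : IsGraphCube G c) (s : unitCube n),
      x = ofCube hc s := by
  obtain ⟨x, n, c, s, hc, hs, rfl⟩ := x
  exact ⟨n, c, hc, ⟨s, hs⟩, rfl⟩

theorem map_ofCube (hφ : IsCubical G φ) {n : ℕ} {c : (Fin n → Bool) → V} (hc : IsGraphCube G c)
    (s : unitCube n) :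
    ∃ (m : ℕ) (c' : (Fin m → Bool) → V) (hc' : IsGraphCube G c') (t : unitCube m),
      map hφ (ofCube hc s) = ofCube hc' t ∧ ∀ b, ∃ a, c' b = φ (c a) := by
  obtain ⟨m, ι, c', hι, hc', h⟩ := hφ.exists_isGraphCube IsMedianGraph.connected hc
  refine ⟨m, c', hc', ⟨reindex ι s, reindex_mem_unitCube ι s.2⟩,
    Subtype.ext (mapDomain_cubePoint hι h s), fun b => ?_⟩
  obtain ⟨a, rfl⟩ := hι.surjective_comp_right b
  exact ⟨a, (h a).symm⟩

theorem dist_ofCube_le {n : ℕ} {c : (Fin n → Bool) → V} (hc : IsGraphCube G c)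
    (s t : unitCube n) : dist (ofCube hc s) (ofCube hc t) ≤ dist s t :=
  InCubeAtDist.dist_le ⟨n, c, s, t, hc, s.2, t.2, rfl, rfl, rfl⟩

omit [IsMedianGraph G] in
theorem ofCube_corner {n : ℕ} {c : (Fin n → Bool) → V} (hc : IsGraphCube G c)
    (a : Fin n → Bool) : ofCube hc ⟨corner a, corner_mem a⟩ = vertex G (c a) :=
  Subtype.ext (cubePoint_corner c a)

theorem isCompact_unitCube (n : ℕ) : IsCompact (unitCube n) := by
  have h : unitCube n =
      EuclideanSpace.equiv (Fin n) ℝ ⁻¹' Set.univ.pi fun _ => Set.Icc (0 : ℝ) 1 := by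
    ext s
    simp only [Set.mem_preimage, Set.mem_univ_pi]
    rfl
  rw [h, ← ContinuousLinearEquiv.coe_toHomeomorph, Homeomorph.isCompact_preimage]
  exact isCompact_univ_pi fun _ => isCompact_Icc

/-- The union of the cubes all of whose vertices lie in `F`. -/
def subcomplex (G : SimpleGraph V) (F : Set V) : Set (CubeComplex G) :=
  {x | ∃ (n : ℕ) (c : (Fin n → Bool) → V) (hc : IsGraphCube G c),
    (∀ a, c a ∈ F) ∧ x ∈ Set.range (ofCube hc)}

theorem isCompact_range_ofCube {n : ℕ} {c : (Fin n → Bool) → V} (hc : IsGraphCube G c) :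
    IsCompact (Set.range (ofCube hc)) := by
  have : CompactSpace (unitCube n) := isCompact_iff_compactSpace.mp (isCompact_unitCube n)
  exact isCompact_range (LipschitzWith.mk_one (dist_ofCube_le hc)).continuous

theorem isCompact_subcomplex (hdim : FiniteDimensional G) {F : Set V} (hF : F.Finite) :
    IsCompact (subcomplex G F) := by
  obtain ⟨N, hN⟩ := hdim
  have := hF.to_subtype
  have h_union : subcomplex G F = ⋃ p : Σ n : Fin (N + 1),
      {c : (Fin n → Bool) → F // IsGraphCube G fun a => (c a : V)},
      Set.range (ofCube p.2.2) := by
    ext x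
    simp only [Set.mem_iUnion]
    constructor
    · rintro ⟨n, c, hc, hcF, hx⟩
      exact ⟨⟨⟨n, Nat.lt_succ_of_le (hN n c hc)⟩, fun a => ⟨c a, hcF a⟩, hc⟩, hx⟩
    · rintro ⟨⟨n, c, hc⟩, hx⟩
      exact ⟨n, _, hc, fun a => (c a).2, hx⟩
  rw [h_union]
  exact isCompact_iUnion fun p => isCompact_range_ofCube p.2.2

end CubeComplex

/-! ## Graph distance and curves in cube complexes -/

theorem norm_prod_sub_prod_le_sum {ι R : Type*} [NormedCommRing R] [NormOneClass R]
    (s : Finset ι) {f g : ι → R} (hf : ∀ i ∈ s, ‖f i‖ ≤ 1) (hg : ∀ i ∈ s, ‖g i‖ ≤ 1) :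
    ‖∏ i ∈ s, f i - ∏ i ∈ s, g i‖ ≤ ∑ i ∈ s, ‖f i - g i‖ := by
  classical
  induction s using Finset.induction_on with
  | empty => simp
  | insert j s hj ih =>
    rw [Finset.forall_mem_insert] at hf hg
    rw [Finset.prod_insert hj, Finset.prod_insert hj, Finset.sum_insert hj]
    have h_tail : ‖∏ i ∈ s, g i‖ ≤ 1 :=
      (Finset.norm_prod_le s g).trans (Finset.prod_le_one (fun _ _ => norm_nonneg _) hg.2)
    calc ‖f j * ∏ i ∈ s, f i - g j * ∏ i ∈ s, g i‖
        = ‖(f j - g j) * ∏ i ∈ s, g i + f j * (∏ i ∈ s, f i - ∏ i ∈ s, g i)‖ := by ring_nf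
      _ ≤ ‖f j - g j‖ * ‖∏ i ∈ s, g i‖ + ‖f j‖ * ‖∏ i ∈ s, f i - ∏ i ∈ s, g i‖ :=
        (norm_add_le _ _).trans (add_le_add (norm_mul_le _ _) (norm_mul_le _ _))
      _ ≤ ‖f j - g j‖ * 1 + 1 * ∑ i ∈ s, ‖f i - g i‖ := by
        gcongr
        exacts [hf.1, ih hf.2 hg.2]
      _ = ‖f j - g j‖ + ∑ i ∈ s, ‖f i - g i‖ := by ring

open scoped NNReal in
theorem lipschitzWith_ite_le {M : Type*} [PseudoMetricSpace M] {f g : ℝ → M} {K : ℝ≥0} {a : ℝ}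
    (hf : LipschitzWith K f) (hg : LipschitzWith K g) (h : f a = g a) :
    LipschitzWith K fun t => if t ≤ a then f t else g t := by
  refine LipschitzWith.of_dist_le_mul fun t t' => ?_
  wlog htt : t ≤ t' generalizing t t'
  · simpa only [dist_comm] using this t' t (le_of_not_ge htt)
  split_ifs with ht ht' ht'
  · exact hf.dist_le_mul t t'
  · calc dist (f t) (g t') ≤ dist (f t) (f a) + dist (g a) (g t') := by
          rw [← h]; exact dist_triangle _ _ _
      _ ≤ K * dist t a + K * dist a t' := add_le_add (hf.dist_le_mul _ _) (hg.dist_le_mul _ _)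
      _ = K * dist t t' := by
        rw [← mul_add, dist_comm t, dist_comm t, Real.dist_eq, Real.dist_eq, Real.dist_eq,
          abs_of_nonneg, abs_of_nonpos, abs_of_nonneg] <;> [skip; linarith; linarith; linarith]
        ring
  · exact absurd (htt.trans ht') ht
  · exact hg.dist_le_mul t t'

namespace CubeComplex

variable {V : Type*} {G : SimpleGraph V}

theorem abs_weight_sub_weight_le {n : ℕ} {s t : EuclideanSpace ℝ (Fin n)} (hs : s ∈ unitCube n)
    (ht : t ∈ unitCube n) (a : Fin n → Bool) : |weight s a - weight t a| ≤ n * dist s t := by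
  have h_factor : ∀ {s : EuclideanSpace ℝ (Fin n)}, s ∈ unitCube n → ∀ i ∈ Finset.univ,
      ‖if a i then s i else 1 - s i‖ ≤ 1 := by
    intro s hs i _
    obtain ⟨h₀, h₁⟩ := hs i
    split_ifs <;> rw [Real.norm_eq_abs, abs_le] <;> constructor <;> linarith
  calc |weight s a - weight t a|
      ≤ ∑ i, ‖(if a i then s i else 1 - s i) - if a i then t i else 1 - t i‖ :=
        norm_prod_sub_prod_le_sum _ (h_factor hs) (h_factor ht)
    _ = ∑ i, ‖(s - t) i‖ := by
        refine Finset.sum_congr rfl fun i _ => ?_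
        split_ifs
        · rfl
        · rw [sub_sub_sub_cancel_left, norm_sub_rev]; rfl
    _ ≤ ∑ _i : Fin n, dist s t :=
        Finset.sum_le_sum fun i _ => dist_eq_norm s t ▸ PiLp.norm_apply_le (s - t) i
    _ = n * dist s t := by simp

/-- The multilinear extension to the cube complex of the graph distance from `o`. -/
noncomputable def distFrom (o : V) (x : CubeComplex G) : ℝ :=
  Finsupp.linearCombination ℝ (fun v => (G.dist o v : ℝ)) x.1

theorem distFrom_vertex (o v : V) : distFrom o (vertex G v) = G.dist o v := by
  simp [distFrom, vertex]

theorem distFrom_eq_sum (o : V) {x : CubeComplex G} {n : ℕ} {c : (Fin n → Bool) → V}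
    {s : EuclideanSpace ℝ (Fin n)} (hx : x.1 = cubePoint c s) :
    distFrom o x = ∑ a, weight s a * G.dist o (c a) := by
  simp [distFrom, hx, cubePoint_eq_sum_weight, Finsupp.linearCombination_single]

theorem abs_dist_sub_dist_le (hG : G.Connected) (o u v : V) :
    |(G.dist o u : ℝ) - G.dist o v| ≤ G.dist u v := by
  have h₁ : (G.dist o u : ℝ) ≤ G.dist o v + G.dist u v := by
    rw [G.dist_comm (u := u)]
    exact_mod_cast hG.dist_triangle
  have h₂ : (G.dist o v : ℝ) ≤ G.dist o u + G.dist u v := by exact_mod_cast hG.dist_triangle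
  rw [abs_le]
  constructor <;> linarith

theorem InCubeAtDist.abs_distFrom_sub_distFrom_le (hG : G.Connected) {N : ℕ}
    (hN : ∀ (n : ℕ) (c : (Fin n → Bool) → V), IsGraphCube G c → n ≤ N) (o : V)
    {x y : CubeComplex G} {r : ℝ} (h : InCubeAtDist G x y r) :
    |distFrom o x - distFrom o y| ≤ 2 ^ N * N * N * r := by
  obtain ⟨n, c, s, t, hc, hs, ht, hx, hy, rfl⟩ := h
  have hn := hN n c hc
  let o' := c fun _ => false
  have h_corner : ∀ a, |(G.dist o (c a) : ℝ) - G.dist o o'| ≤ n := fun a => by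
    refine (abs_dist_sub_dist_le hG o _ _).trans ?_
    rw [hc]
    exact_mod_cast hammingDist_le_card_fintype.trans (Fintype.card_fin n).le
  calc |distFrom o x - distFrom o y|
      = |∑ a, (weight s a - weight t a) * ((G.dist o (c a) : ℝ) - G.dist o o')| := by
        rw [distFrom_eq_sum o hx, distFrom_eq_sum o hy]
        simp only [mul_sub, sub_mul, Finset.sum_sub_distrib, ← Finset.sum_mul, sum_weight]
        ring_nf
    _ ≤ ∑ _a : Fin n → Bool, n * dist s t * n := by
        refine (Finset.abs_sum_le_sum_abs _ _).trans (Finset.sum_le_sum fun a _ => ?_)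
        rw [abs_mul]
        exact mul_le_mul (abs_weight_sub_weight_le hs ht a) (h_corner a) (abs_nonneg _)
          (by positivity)
    _ = 2 ^ n * n * n * dist s t := by simp; ring
    _ ≤ 2 ^ N * N * N * dist s t := by
        gcongr
        norm_num

section

variable [IsMedianGraph G]

theorem exists_dist_le_mul_dist_vertex (hdim : FiniteDimensional G) :
    ∃ K : ℝ, 0 ≤ K ∧ ∀ u v, (G.dist u v : ℝ) ≤ K * dist (vertex G u) (vertex G v) := by
  obtain ⟨N, hN⟩ := hdim
  refine ⟨2 ^ N * N * N, by positivity, fun u v => ?_⟩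
  have h_lip : LipschitzWith (2 ^ N * N * N) (distFrom (G := G) u) :=
    lipschitzWith_of_inCubeAtDist fun x y r h => by
      simpa [Real.dist_eq] using h.abs_distFrom_sub_distFrom_le IsMedianGraph.connected hN u
  simpa [distFrom_vertex, Real.dist_eq] using h_lip.dist_le_mul (vertex G u) (vertex G v)

theorem dist_vertex_le_one {u v : V} (h : G.Adj u v) : dist (vertex G u) (vertex G v) ≤ 1 := by
  have h_edge := dist_ofCube_le (isGraphCube_edge h) ⟨_, corner_mem fun _ => false⟩
    ⟨_, corner_mem fun _ => true⟩
  rw [ofCube_corner, ofCube_corner, Subtype.dist_eq, EuclideanSpace.dist_eq] at h_edge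
  simpa [corner] using h_edge

theorem dist_ofCube_vertex_le {n : ℕ} {c : (Fin n → Bool) → V} (hc : IsGraphCube G c)
    (s : unitCube n) (a : Fin n → Bool) : dist (ofCube hc s) (vertex G (c a)) ≤ n := by
  rw [← ofCube_corner hc]
  refine (dist_ofCube_le hc _ _).trans ?_
  rw [Subtype.dist_eq, EuclideanSpace.dist_eq, Real.sqrt_le_left (by positivity)]
  calc ∑ i, dist (s.1 i) (corner a i) ^ 2 ≤ ∑ _i : Fin n, 1 :=
        Finset.sum_le_sum fun i _ =>
          pow_le_one₀ dist_nonneg ((Real.dist_le_of_mem_Icc_01 (s.2 i) (corner_mem a i)))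
    _ = n := by simp
    _ ≤ (n : ℝ) ^ 2 := by exact_mod_cast Nat.le_self_pow two_ne_zero n

theorem convex_unitCube (n : ℕ) : Convex ℝ (unitCube n) := by
  intro s hs t ht a b ha hb hab i
  exact convex_Icc (0 : ℝ) 1 (hs i) (ht i) ha hb hab

theorem InCubeAtDist.exists_curve {x y : CubeComplex G} {r : ℝ} (h : InCubeAtDist G x y r) :
    ∃ γ : ℝ → CubeComplex G, LipschitzWith 1 γ ∧ γ 0 = x ∧ γ r = y := by
  obtain ⟨n, c, s, t, hc, hs, ht, hx, hy, rfl⟩ := h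
  let u : ℝ → unitCube n := fun τ => ⟨AffineMap.lineMap s t
    (Set.projIcc (0 : ℝ) 1 zero_le_one (τ / dist s t) : ℝ),
      (convex_unitCube n).lineMap_mem hs ht (Set.projIcc (0 : ℝ) 1 zero_le_one _).2⟩
  refine ⟨fun τ => ofCube hc (u τ), LipschitzWith.mk_one fun τ τ' => ?_, ?_, ?_⟩
  · refine (dist_ofCube_le hc _ _).trans ?_
    rw [Subtype.dist_eq, dist_lineMap_lineMap, Real.dist_eq, Real.dist_eq]
    calc _ ≤ |τ / dist s t - τ' / dist s t| * dist s t :=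
          mul_le_mul_of_nonneg_right (Set.abs_projIcc_sub_projIcc _) dist_nonneg
      _ = |τ - τ'| * (dist s t / dist s t) := by
          rw [← sub_div, abs_div, abs_of_nonneg dist_nonneg]; ring
      _ ≤ |τ - τ'| := mul_le_of_le_one_right (abs_nonneg _) (div_self_le_one _)
  · exact Subtype.ext (by simp [ofCube, u, hx])
  · rcases eq_or_ne s t with rfl | hst
    · exact Subtype.ext (by simp [ofCube, u, hy])
    · exact Subtype.ext (by simp [ofCube, u, hy, div_self (dist_ne_zero.mpr hst)])

theorem PathOfLength.exists_curve {x y : CubeComplex G} {l : ℝ} (h : PathOfLength G x y l) :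
    ∃ γ : ℝ → CubeComplex G, LipschitzWith 1 γ ∧ γ 0 = x ∧ γ l = y := by
  induction h with
  | refl => exact ⟨fun _ => x, LipschitzWith.const' x, rfl, rfl⟩
  | @snoc y z l r hp hc ih =>
    obtain ⟨γ, hγ, hγ₀, hγl⟩ := ih
    obtain ⟨σ, hσ, hσ₀, hσr⟩ := hc.exists_curve
    have h_shift : LipschitzWith 1 fun t => σ (t - l) :=
      LipschitzWith.mk_one fun t t' => by simpa using hσ.dist_le_mul (t - l) (t' - l)
    refine ⟨fun t => if t ≤ l then γ t else σ (t - l),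
      lipschitzWith_ite_le hγ h_shift (by simp [hγl, hσ₀]), by simp [hp.nonneg, hγ₀], ?_⟩
    dsimp only
    split_ifs with hr
    · obtain rfl : r = 0 := by linarith [hc.path.nonneg]
      rw [add_zero, hγl, ← hσ₀, hσr]
    · rw [add_sub_cancel_left, hσr]

end

end CubeComplex

/-! ## Quasiisometries of subsets of the line -/

theorem exists_abs_sub_le_of_chain {h : ℕ → ℝ} {k E : ℝ} {L : ℕ} (h_left : h 0 ≤ k + E)
    (h_right : k - E ≤ h L) (h_step : ∀ l < L, |h l - h (l + 1)| ≤ E) :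
    ∃ l ≤ L, |h l - k| ≤ E := by
  induction L with
  | zero => exact ⟨0, le_rfl, abs_le.mpr ⟨by linarith, by linarith⟩⟩
  | succ L ih =>
    rcases le_or_gt (k - E) (h L) with hL | hL
    · obtain ⟨l, hl, h_close⟩ := ih hL fun l hl => h_step l (hl.trans L.lt_succ_self)
      exact ⟨l, hl.trans L.le_succ, h_close⟩
    · have := abs_le.mp (h_step L L.lt_succ_self)
      exact ⟨L + 1, le_rfl, abs_le.mpr ⟨by linarith, by linarith⟩⟩

theorem QuasiIsometric.comp_isometryEquiv {X X' Y : Type*} [PseudoMetricSpace X]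
    [PseudoMetricSpace X'] [PseudoMetricSpace Y] (h : QuasiIsometric X Y) (e : X' ≃ᵢ X) :
    QuasiIsometric X' Y := by
  obtain ⟨f, q, hq, h_embed, h_dense⟩ := h
  refine ⟨f ∘ e, q, hq, fun x x' => ?_, fun y => ?_⟩
  · simpa only [e.dist_eq, Function.comp_apply] using h_embed (e x) (e x')
  · obtain ⟨x, hx⟩ := h_dense y
    exact ⟨e.symm x, by simpa using hx⟩

namespace IsQuasiIsometry

theorem exists_coarseInverse {X Y : Type*} [PseudoMetricSpace X] [PseudoMetricSpace Y]
    {f : X → Y} (hf : IsQuasiIsometry f) :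
    ∃ (τ : Y → X) (C : ℝ), 0 ≤ C ∧ ∀ y x, dist (τ y) x ≤ C * (dist y (f x) + 1) ∧
      dist y (f x) ≤ C * (dist (τ y) x + 1) := by
  obtain ⟨q, hq, h_embed, h_dense⟩ := hf
  choose τ hτ using h_dense
  refine ⟨τ, 2 * q ^ 2, by positivity, fun y x => ⟨?_, ?_⟩⟩
  · have h_lower := (h_embed (τ y) x).1
    rw [sub_le_iff_le_add, inv_mul_le_iff₀ (zero_lt_one.trans_le hq)] at h_lower
    calc dist (τ y) x ≤ q * (dist (f (τ y)) (f x) + q) := h_lower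
      _ ≤ q * (q + dist y (f x) + q) := by
        gcongr
        exact (dist_triangle _ y _).trans (add_le_add_left (hτ y) _)
      _ ≤ 2 * q ^ 2 * (dist y (f x) + 1) := by
        nlinarith [mul_nonneg (show 0 ≤ q * (2 * q - 1) by nlinarith)
          (dist_nonneg (x := y) (y := f x))]
  · calc dist y (f x) ≤ dist (f (τ y)) y + dist (f (τ y)) (f x) := dist_triangle_left _ _ _
      _ ≤ q + (q * dist (τ y) x + q) := add_le_add (hτ y) (h_embed _ _).2
      _ ≤ 2 * q * (dist (τ y) x + 1) := by nlinarith [dist_nonneg (x := τ y) (y := x)]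
      _ ≤ 2 * q ^ 2 * (dist (τ y) x + 1) := by
        gcongr
        exact le_self_pow₀ hq two_ne_zero

theorem exists_forall_le_dist {X Y : Type*} [PseudoMetricSpace X] [PseudoMetricSpace Y]
    {f : X → Y} (hf : IsQuasiIsometry f) (o : X) (y : Y) (r : ℝ) :
    ∃ ρ, ∀ x, ρ ≤ dist x o → r ≤ dist (f x) y := by
  obtain ⟨q, hq, h_embed, -⟩ := hf
  refine ⟨q * (r + dist y (f o) + q), fun x hx => ?_⟩
  have h_scaled : r + dist y (f o) + q ≤ q⁻¹ * dist x o :=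
    (le_inv_mul_iff₀ (zero_lt_one.trans_le hq)).mpr hx
  linarith [(h_embed x o).1, dist_triangle (f x) y (f o)]

variable {M : Type*} [PseudoMetricSpace M] {S : Set ℝ} {f : S → M}

theorem exists_chain_dist_le (hf : IsQuasiIsometry f) (D : ℝ) :
    ∃ R, ∀ (a k b : S) (g : ℕ → M) (L : ℕ), a ≤ k → k ≤ b →
      (∀ l < L, dist (g l) (g (l + 1)) ≤ 1) → dist (g 0) (f a) ≤ D → dist (g L) (f b) ≤ D →
      ∃ l ≤ L, dist (g l) (f k) ≤ R := by
  obtain ⟨τ, C, hC, hτ⟩ := hf.exists_coarseInverse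
  let E := max (C * (D + 1)) (C * (C + 2))
  have h_end : ∀ x s, dist x (f s) ≤ D → |(τ x : ℝ) - s| ≤ E := fun x s h =>
    calc |(τ x : ℝ) - s| ≤ C * (dist x (f s) + 1) := (hτ x s).1
      _ ≤ C * (D + 1) := by gcongr
      _ ≤ E := le_max_left _ _
  have h_step : ∀ x y, dist x y ≤ 1 → |(τ x : ℝ) - τ y| ≤ E := fun x y h =>
    calc |(τ x : ℝ) - τ y| ≤ C * (dist x (f (τ y)) + 1) := (hτ x (τ y)).1
      _ ≤ C * (1 + C * (0 + 1) + 1) := by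
        gcongr
        exact (dist_triangle x y _).trans (add_le_add h (by simpa using (hτ y (τ y)).2))
      _ = C * (C + 2) := by ring
      _ ≤ E := le_max_right _ _
  refine ⟨C * (E + 1), fun a k b g L hak hkb hg ha hb => ?_⟩
  have h_le : (a : ℝ) ≤ k ∧ (k : ℝ) ≤ b := ⟨hak, hkb⟩
  obtain ⟨l, hl, h_close⟩ := exists_abs_sub_le_of_chain (h := fun l => τ (g l)) (k := k) (E := E)
    (by linarith [(abs_le.mp (h_end _ _ ha)).2]) (by linarith [(abs_le.mp (h_end _ _ hb)).1])
    fun l hl => h_step _ _ (hg l hl)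
  exact ⟨l, hl, (hτ _ _).2.trans (mul_le_mul_of_nonneg_left (add_le_add_left h_close 1) hC)⟩

theorem exists_le_le_dist (hf : IsQuasiIsometry f) (hS : ¬BddBelow S) (o : S) (x : M) (r : ℝ) :
    ∃ a ≤ o, r ≤ dist (f a) x := by
  obtain ⟨ρ, hρ⟩ := hf.exists_forall_le_dist o x r
  obtain ⟨a, haS, ha⟩ := not_bddBelow_iff.mp hS (o - |ρ|)
  have hao : a ≤ o := by linarith [abs_nonneg ρ]
  refine ⟨⟨a, haS⟩, hao, hρ _ ?_⟩
  rw [dist_comm, Subtype.dist_eq, Real.dist_eq, abs_of_nonneg (sub_nonneg.mpr hao)]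
  linarith [le_abs_self ρ]

theorem exists_ge_le_dist (hf : IsQuasiIsometry f) (hS : ¬BddAbove S) (o : S) (x : M) (r : ℝ) :
    ∃ b ≥ o, r ≤ dist (f b) x := by
  obtain ⟨ρ, hρ⟩ := hf.exists_forall_le_dist o x r
  obtain ⟨b, hbS, hb⟩ := not_bddAbove_iff.mp hS (o + |ρ|)
  have hob : o ≤ b := by linarith [abs_nonneg ρ]
  refine ⟨⟨b, hbS⟩, hob, hρ _ ?_⟩
  rw [Subtype.dist_eq, Real.dist_eq, abs_of_nonneg (sub_nonneg.mpr hob)]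
  linarith [le_abs_self ρ]

theorem exists_curve_dist_le (hf : IsQuasiIsometry f) (D : ℝ) :
    ∃ R, ∀ (a k b : S) (γ : ℝ → M) (l : ℝ), a ≤ k → k ≤ b → LipschitzWith 1 γ → 0 ≤ l →
      dist (γ 0) (f a) ≤ D → dist (γ l) (f b) ≤ D →
      ∃ t ∈ Set.Icc 0 l, dist (γ t) (f k) ≤ R := by
  obtain ⟨R, hR⟩ := hf.exists_chain_dist_le D
  refine ⟨R, fun a k b γ l hak hkb hγ hl ha hb => ?_⟩
  have h_step : ∀ i < ⌈l⌉₊, dist (γ (min i l)) (γ (min (i + 1 : ℕ) l)) ≤ 1 := fun i _ => by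
    simpa using (hγ.comp (LipschitzWith.id.min_const l)).dist_le_mul (i : ℝ) (i + 1 : ℕ)
  obtain ⟨i, -, hi⟩ := hR a k b (fun i => γ (min i l)) ⌈l⌉₊ hak hkb h_step
    (by simpa [hl] using ha) (by simpa [min_eq_right (Nat.le_ceil l)] using hb)
  exact ⟨_, ⟨le_min i.cast_nonneg hl, min_le_right _ _⟩, hi⟩

end IsQuasiIsometry

/-! ## Limits of almost geodesics -/

section AlmostGeodesics

open Filter Topology

variable {M : Type*} [PseudoMetricSpace M]

/-- A `1`-Lipschitz curve that is a geodesic on `[a, b]` up to the additive error `ε`. It is defined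
on all of `ℝ` so that no subtypes are needed. -/
structure IsAlmostGeodesic (γ : ℝ → M) (a b ε : ℝ) : Prop where
  lipschitzWith : LipschitzWith 1 γ
  sub_le : b - a ≤ dist (γ a) (γ b) + ε

/-- The intersections of `Z` with the balls of the ambient space are relatively compact. -/
def HasRelCompactBalls (Z : Set M) : Prop :=
  ∀ x r, ∃ K, IsCompact K ∧ Z ∩ Metric.closedBall x r ⊆ K

/-- The points of `Z` are joined by curves in `Z` that are almost as short as the distance in the
ambient space allows. -/
def IsLengthSubspace (Z : Set M) : Prop :=
  ∀ x ∈ Z, ∀ y ∈ Z, ∀ ε > 0, ∃ (l : ℝ) (γ : ℝ → M), 0 ≤ l ∧ IsAlmostGeodesic γ 0 l ε ∧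
    γ 0 = x ∧ γ l = y ∧ ∀ t, γ t ∈ Z

theorem IsAlmostGeodesic.mono {γ : ℝ → M} {a b s t ε : ℝ} (h : IsAlmostGeodesic γ a b ε)
    (has : a ≤ s) (htb : t ≤ b) : IsAlmostGeodesic γ s t ε := by
  refine ⟨h.lipschitzWith, ?_⟩
  have h_left : dist (γ a) (γ s) ≤ s - a := by
    simpa [Real.dist_eq, abs_sub_comm a, abs_of_nonneg (sub_nonneg.mpr has)] using
      h.lipschitzWith.dist_le_mul a s
  have h_right : dist (γ t) (γ b) ≤ b - t := by
    simpa [Real.dist_eq, abs_sub_comm t, abs_of_nonneg (sub_nonneg.mpr htb)] using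
      h.lipschitzWith.dist_le_mul t b
  linarith [h.sub_le, dist_triangle4 (γ a) (γ s) (γ t) (γ b)]

theorem IsAlmostGeodesic.comp_const_add {γ : ℝ → M} {a b ε : ℝ} (h : IsAlmostGeodesic γ a b ε)
    (c : ℝ) : IsAlmostGeodesic (fun t => γ (c + t)) (a - c) (b - c) ε :=
  ⟨LipschitzWith.mk_one fun s t => by simpa using h.lipschitzWith.dist_le_mul (c + s) (c + t),
    by simpa using h.sub_le⟩

theorem exists_isometry_of_isAlmostGeodesic {ι : Type*} {l : Filter ι} [l.NeBot] {J : Set ℝ}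
    {δ : ι → ℝ → M} {ε : ι → ℝ} (h_cpt : ∀ t ∈ J, ∃ K, IsCompact K ∧ ∀ᶠ i in l, δ i t ∈ K)
    (h_geod : ∀ s ∈ J, ∀ t ∈ J, s ≤ t → ∀ᶠ i in l, IsAlmostGeodesic (δ i) s t (ε i))
    (hε : Tendsto ε l (𝓝 0)) : ∃ γ : J → M, Isometry γ := by
  have h_lim : ∀ t : J, ∃ x, Tendsto (fun i => δ i t) (Ultrafilter.of l) (𝓝 x) := fun t => by
    obtain ⟨K, hK, h_mem⟩ := h_cpt t t.2
    obtain ⟨x, -, hx⟩ := hK.ultrafilter_le_nhds ((Ultrafilter.of l).map fun i => δ i t)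
      (le_principal_iff.mpr (Ultrafilter.of_le l h_mem))
    exact ⟨x, hx⟩
  choose γ hγ using h_lim
  refine ⟨γ, Isometry.of_dist_eq fun s t => ?_⟩
  wlog hst : s ≤ t generalizing s t
  · simpa only [dist_comm] using this t s (le_of_not_ge hst)
  have h_lower : Tendsto (fun i => dist s t - ε i) l (𝓝 (dist s t)) := by
    simpa using tendsto_const_nhds.sub hε
  refine tendsto_nhds_unique ((hγ s).dist (hγ t)) (Tendsto.mono_left
    (tendsto_of_tendsto_of_tendsto_of_le_of_le' h_lower tendsto_const_nhds ?_ ?_)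
    (Ultrafilter.of_le l))
  · filter_upwards [h_geod s s.2 t t.2 hst] with i hi
    have h_dist : dist s t = t - s := by
      rw [dist_comm, Subtype.dist_eq, Real.dist_eq, abs_of_nonneg]
      exact sub_nonneg.mpr hst
    rw [h_dist]
    exact sub_le_iff_le_add.mpr hi.sub_le
  · filter_upwards [h_geod s s.2 t t.2 hst] with i hi
    simpa [Subtype.dist_eq] using hi.lipschitzWith.dist_le_mul s t

theorem HasRelCompactBalls.exists_isometry {Z : Set M} (hZ : HasRelCompactBalls Z) {J : Set ℝ}
    {x : M} {R : ℝ}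
    (h : ∀ r, ∀ ε > 0, ∃ δ : ℝ → M, dist (δ 0) x ≤ R ∧ (∀ t, δ t ∈ Z) ∧
      ∀ s ∈ J, ∀ t ∈ J, -r ≤ s → t ≤ r → IsAlmostGeodesic δ s t ε) :
    ∃ γ : J → M, Isometry γ := by
  choose δ h_base hδZ h_geod using fun n : ℕ => h n _ (Nat.one_div_pos_of_nat (α := ℝ) (n := n))
  have h_ev : ∀ s ∈ J, ∀ t ∈ J, s ≤ t →
      ∀ᶠ n : ℕ in atTop, IsAlmostGeodesic (δ n) s t (1 / ((n : ℝ) + 1)) := fun s hs t ht _ => by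
    filter_upwards [tendsto_natCast_atTop_atTop.eventually_ge_atTop (-s),
      tendsto_natCast_atTop_atTop.eventually_ge_atTop t] with n hns hnt
    exact h_geod n s hs t ht (neg_le.mp hns) hnt
  refine exists_isometry_of_isAlmostGeodesic (fun t ht => ?_) h_ev
    tendsto_one_div_add_atTop_nhds_zero_nat
  obtain ⟨K, hK, h_sub⟩ := hZ x (|t| + R)
  refine ⟨K, hK, (h_ev t ht t ht le_rfl).mono fun n hn => h_sub ⟨hδZ n t, ?_⟩⟩
  have h_lip : dist (δ n t) (δ n 0) ≤ |t| := by simpa using hn.lipschitzWith.dist_le_mul t 0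
  exact (dist_triangle _ _ _).trans (add_le_add h_lip (h_base n))

theorem IsLengthSubspace.exists_isometry_Ici {Z : Set M} (hZ : IsLengthSubspace Z)
    (hZ_balls : HasRelCompactBalls Z) (hZ_unbdd : ¬Bornology.IsBounded Z) :
    ∃ γ : Set.Ici (0 : ℝ) → M, Isometry γ := by
  obtain ⟨x, hx⟩ : Z.Nonempty := Set.nonempty_iff_ne_empty.mpr fun h =>
    hZ_unbdd (h ▸ Bornology.isBounded_empty)
  refine hZ_balls.exists_isometry (x := x) (R := 0) fun r ε hε => ?_
  obtain ⟨y, hy, hxy⟩ : ∃ y ∈ Z, r < dist y x := by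
    by_contra! h
    exact hZ_unbdd ((Metric.isBounded_iff_subset_closedBall x).mpr ⟨r, h⟩)
  obtain ⟨l, γ, hl, hγ, hγ₀, hγl, hγZ⟩ := hZ x hx y hy ε hε
  have h_len : dist y x ≤ l := by
    simpa [hγ₀, hγl, abs_of_nonneg hl] using hγ.lipschitzWith.dist_le_mul l 0
  exact ⟨γ, by simp [hγ₀], hγZ, fun s hs t _ _ htr => hγ.mono hs (by linarith)⟩

theorem IsLengthSubspace.exists_isAlmostGeodesic {Z : Set M} (hZ : IsLengthSubspace Z)
    {S : Set ℝ} {f : S → M} (hf : IsQuasiIsometry f) (hS_below : ¬BddBelow S)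
    (hS_above : ¬BddAbove S) {C : ℝ} (hfZ : ∀ s, ∃ z ∈ Z, dist z (f s) ≤ C) (o : S) :
    ∃ R, ∀ r, ∀ ε > 0, ∃ δ : ℝ → M, dist (δ 0) (f o) ≤ R ∧ (∀ t, δ t ∈ Z) ∧
      IsAlmostGeodesic δ (-r) r ε := by
  choose p hpZ hp using hfZ
  obtain ⟨R, hR⟩ := hf.exists_curve_dist_le C
  refine ⟨R, fun r ε hε => ?_⟩
  obtain ⟨a, hao, ha⟩ := hf.exists_le_le_dist hS_below o (f o) (r + C + R)
  obtain ⟨b, hob, hb⟩ := hf.exists_ge_le_dist hS_above o (f o) (r + C + R)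
  obtain ⟨l, γ, hl, hγ, hγ₀, hγl, hγZ⟩ := hZ _ (hpZ a) _ (hpZ b) ε hε
  obtain ⟨t, ⟨ht₀, htl⟩, ht⟩ := hR a o b γ l hao hob hγ.lipschitzWith hl (hγ₀ ▸ hp a) (hγl ▸ hp b)
  have h_left : dist (γ 0) (γ t) ≤ t := by
    simpa [abs_of_nonneg ht₀] using hγ.lipschitzWith.dist_le_mul 0 t
  have h_right : dist (γ l) (γ t) ≤ l - t := by
    simpa [Real.dist_eq, abs_of_nonneg (sub_nonneg.mpr htl)] using
      hγ.lipschitzWith.dist_le_mul l t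
  rw [hγ₀] at h_left
  rw [hγl] at h_right
  refine ⟨fun u => γ (t + u), by simpa using ht, fun u => hγZ _,
    (hγ.comp_const_add t).mono ?_ ?_⟩
  · linarith [hp a, dist_triangle4 (f a) (p a) (γ t) (f o), dist_comm (f a) (p a)]
  · linarith [hp b, dist_triangle4 (f b) (p b) (γ t) (f o), dist_comm (f b) (p b)]

theorem IsLengthSubspace.exists_isometry_real {Z : Set M} (hZ : IsLengthSubspace Z)
    (hZ_balls : HasRelCompactBalls Z) {S : Set ℝ} {f : S → M} (hf : IsQuasiIsometry f)
    (hS_below : ¬BddBelow S) (hS_above : ¬BddAbove S) {C : ℝ}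
    (hfZ : ∀ s, ∃ z ∈ Z, dist z (f s) ≤ C) : ∃ γ : ℝ → M, Isometry γ := by
  obtain ⟨o, ho⟩ := nonempty_of_not_bddBelow hS_below
  obtain ⟨R, hR⟩ := hZ.exists_isAlmostGeodesic hf hS_below hS_above hfZ ⟨o, ho⟩
  obtain ⟨γ, hγ⟩ := hZ_balls.exists_isometry (J := Set.univ) fun r ε hε => by
    obtain ⟨δ, h_base, hδZ, hδ⟩ := hR r ε hε
    exact ⟨δ, h_base, hδZ, fun s _ t _ hs ht => hδ.mono hs ht⟩
  exact ⟨fun t => γ ⟨t, trivial⟩, fun s t => hγ _ _⟩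

end AlmostGeodesics

/-! ## Cube complexes quasiisometric to subsets of the line -/

theorem exists_geodBtw_chain {V : Type*} {G : SimpleGraph V} (hG : G.Connected) (x y : V) :
    ∃ v : ℕ → V, v 0 = x ∧ v (G.dist x y) = y ∧ (∀ l < G.dist x y, G.Adj (v l) (v (l + 1))) ∧
      ∀ l ≤ G.dist x y, GeodBtw G x (v l) y := by
  obtain ⟨p, hp⟩ := hG.exists_walk_length_eq_dist x y
  refine ⟨p.getVert, p.getVert_zero, hp ▸ p.getVert_length,
    fun l hl => p.adj_getVert_succ (hp ▸ hl), fun l hl => ?_⟩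
  have h_take := SimpleGraph.dist_le (p.take l)
  have h_drop := SimpleGraph.dist_le (p.drop l)
  have h_triangle := hG.dist_triangle (u := x) (v := p.getVert l) (w := y)
  rw [p.take_length] at h_take
  rw [p.drop_length] at h_drop
  unfold GeodBtw
  omega

namespace IsMedianGraph

variable {V : Type*} {G : SimpleGraph V} [IsMedianGraph G]

theorem two_mul_dist_med (a x b : V) :
    2 * G.dist x (med G a x b) + G.dist a b = G.dist a x + G.dist x b := by
  have h₁₂ := geodBtw_med₁₂ (G := G) a x b
  have h₂₃ := geodBtw_med₂₃ (G := G) a x b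
  have h₁₃ := geodBtw_med₁₃ (G := G) a x b
  unfold GeodBtw at *
  rw [G.dist_comm (u := med G a x b) (v := x)] at h₁₂
  omega

theorem dist_med_le_dist_of_geodBtw {a v b : V} (h : GeodBtw G a v b) (x : V) :
    G.dist x (med G a x b) ≤ G.dist v x := by
  have h_med := two_mul_dist_med (G := G) a x b
  have h_left := (connected (G := G)).dist_triangle (u := a) (v := v) (w := x)
  have h_right := (connected (G := G)).dist_triangle (u := x) (v := v) (w := b)
  rw [G.dist_comm (u := x) (v := v)] at h_right
  unfold GeodBtw at h
  omega

theorem dist_med_le_add (a b x y : V) :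
    G.dist x (med G a x b) ≤ G.dist x y + G.dist y (med G a y b) := by
  have hx := two_mul_dist_med (G := G) a x b
  have hy := two_mul_dist_med (G := G) a y b
  have h_left := (connected (G := G)).dist_triangle (u := a) (v := y) (w := x)
  have h_right := (connected (G := G)).dist_triangle (u := x) (v := y) (w := b)
  rw [G.dist_comm (u := y) (v := x)] at h_left
  omega

open Filter in
theorem exists_isEndRetraction_of_dist_med_le (hdim : CubeComplex.FiniteDimensional G)
    {ι : Type*} [Nonempty ι] [Preorder ι] [IsDirectedOrder ι] [IsCodirectedOrder ι] {p : ι → V}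
    {R : ℕ} (hR : ∀ a k b, a ≤ k → k ≤ b → G.dist (p k) (med G (p a) (p k) (p b)) ≤ R) :
    ∃ 𝒜 ℬ φ, IsEndRetraction G 𝒜 ℬ φ ∧ ∀ k, G.dist (p k) (φ (p k)) ≤ R := by
  let 𝒜 : Ultrafilter V := (Ultrafilter.of atBot).map p
  let ℬ : Ultrafilter V := (Ultrafilter.of atTop).map p
  have h_chain : ∀ k, ∀ᶠ a in 𝒜, ∀ᶠ b in ℬ, G.dist (p k) (med G a (p k) b) ≤ R := fun k =>
    ((eventually_le_atBot k).filter_mono (Ultrafilter.of_le _)).mono fun a ha =>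
      ((eventually_ge_atTop k).filter_mono (Ultrafilter.of_le _)).mono fun b hb => hR a k b ha hb
  have h_all : ∀ x, ∃ R : ℕ, ∀ᶠ a in 𝒜, ∀ᶠ b in ℬ, G.dist x (med G a x b) ≤ R := by
    intro x
    obtain ⟨k⟩ := ‹Nonempty ι›
    refine ⟨G.dist x (p k) + R, (h_chain k).mono fun a ha => ha.mono fun b hb => ?_⟩
    exact (dist_med_le_add a b x (p k)).trans (Nat.add_le_add_left hb _)
  obtain ⟨φ, hφ, hφ_dist⟩ := exists_isEndRetraction hdim h_all
  exact ⟨𝒜, ℬ, φ, hφ, fun k => hφ_dist (p k) R (h_chain k)⟩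

end IsMedianGraph

theorem IsLengthSubspace.range {M : Type*} [PseudoMetricSpace M]
    (hM : IsLengthSubspace (Set.univ : Set M)) {Φ : M → M} (hΦ : LipschitzWith 1 Φ)
    (h_idem : ∀ x, Φ (Φ x) = Φ x) : IsLengthSubspace (Set.range Φ) := by
  rintro _ ⟨x, rfl⟩ _ ⟨y, rfl⟩ ε hε
  obtain ⟨l, γ, hl, hγ, hγ₀, hγl, -⟩ := hM (Φ x) trivial (Φ y) trivial ε hε
  have h₀ : (Φ ∘ γ) 0 = Φ x := by simp [hγ₀, h_idem]
  have hl' : (Φ ∘ γ) l = Φ y := by simp [hγl, h_idem]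
  refine ⟨l, Φ ∘ γ, hl, ⟨by simpa using hΦ.comp hγ.lipschitzWith, ?_⟩, h₀, hl',
    fun t => Set.mem_range_self _⟩
  rw [h₀, hl', ← hγ₀, ← hγl]
  exact hγ.sub_le

namespace CubeComplex

open IsMedianGraph

variable {V : Type*} {G : SimpleGraph V} [IsMedianGraph G]

theorem isLengthSubspace_univ : IsLengthSubspace (Set.univ : Set (CubeComplex G)) := by
  intro x _ y _ ε hε
  obtain ⟨l, hl, hlε⟩ := exists_pathOfLength_lt x y hε
  obtain ⟨γ, hγ, rfl, rfl⟩ := hl.exists_curve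
  exact ⟨l, γ, hl.nonneg, ⟨hγ, by linarith⟩, rfl, rfl, fun _ => trivial⟩

theorem dist_vertex_le (u v : V) : dist (vertex G u) (vertex G v) ≤ G.dist u v := by
  obtain ⟨w, hw₀, hw₁, h_adj, -⟩ := exists_geodBtw_chain (connected (G := G)) u v
  have h := dist_le_range_sum_of_dist_le (f := fun l => vertex G (w l)) (d := fun _ => 1)
    (G.dist u v) fun hl => dist_vertex_le_one (h_adj _ hl)
  simpa [hw₀, hw₁] using h

theorem exists_forall_exists_dist_vertex_le (hdim : FiniteDimensional G) :
    ∃ D, ∀ x : CubeComplex G, ∃ v, dist (vertex G v) x ≤ D := by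
  obtain ⟨N, hN⟩ := hdim
  refine ⟨N, fun x => ?_⟩
  obtain ⟨n, c, hc, s, rfl⟩ := exists_eq_ofCube x
  refine ⟨c fun _ => false, ?_⟩
  rw [dist_comm]
  exact (dist_ofCube_vertex_le hc s _).trans (by exact_mod_cast hN n c hc)

/-- The vertices on a geodesic between `p a` and `p b` form a coarse path from `f a` to `f b`, so
one of them is close to `f k`. -/
theorem exists_dist_med_le (hdim : FiniteDimensional G) {S : Set ℝ} {f : S → CubeComplex G}
    (hf : IsQuasiIsometry f) {p : S → V} {D : ℝ} (hp : ∀ k, dist (vertex G (p k)) (f k) ≤ D) :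
    ∃ R : ℕ, ∀ a k b, a ≤ k → k ≤ b → G.dist (p k) (med G (p a) (p k) (p b)) ≤ R := by
  obtain ⟨K, hK, hK_dist⟩ := exists_dist_le_mul_dist_vertex hdim
  obtain ⟨R, hR⟩ := hf.exists_chain_dist_le D
  refine ⟨⌈K * (R + D)⌉₊, fun a k b hak hkb => ?_⟩
  obtain ⟨v, hv₀, hv₁, h_adj, h_btw⟩ := exists_geodBtw_chain (connected (G := G)) (p a) (p b)
  obtain ⟨l, hl, hlk⟩ := hR a k b (fun l => vertex G (v l)) _ hak hkb
    (fun l hl => dist_vertex_le_one (h_adj l hl)) (hv₀ ▸ hp a) (by simpa only [hv₁] using hp b)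
  have h_close : (G.dist (v l) (p k) : ℝ) ≤ K * (R + D) :=
    (hK_dist _ _).trans (mul_le_mul_of_nonneg_left
      ((dist_triangle_right _ _ (f k)).trans (add_le_add hlk (hp k))) hK)
  exact (dist_med_le_dist_of_geodBtw (h_btw l hl) (p k)).trans
    (by exact_mod_cast h_close.trans (Nat.le_ceil _))

theorem hasRelCompactBalls_range_map (hdim : FiniteDimensional G) {φ : V → V}
    (hφ : IsCubical G φ) (h_idem : ∀ v, φ (φ v) = φ v)
    (h_fin : ∀ o, φ o = o → ∀ R : ℕ, {v | φ v = v ∧ G.dist o v ≤ R}.Finite) :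
    HasRelCompactBalls (Set.range (map hφ)) := by
  intro x r
  obtain ⟨o⟩ := (connected (G := G)).nonempty
  obtain ⟨K, hK, hK_dist⟩ := exists_dist_le_mul_dist_vertex hdim
  obtain ⟨N, hN⟩ := id hdim
  refine ⟨_, isCompact_subcomplex hdim (h_fin (φ o) (h_idem o)
    ⌈K * (dist (vertex G (φ o)) x + r + N)⌉₊), ?_⟩
  rintro _ ⟨⟨y, rfl⟩, hy⟩
  obtain ⟨n, c, hc, s, rfl⟩ := exists_eq_ofCube y
  obtain ⟨m, c', hc', t, ht, hc'_eq⟩ := map_ofCube hφ hc s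
  rw [ht, Metric.mem_closedBall, dist_comm] at hy
  rw [ht]
  refine ⟨m, c', hc', fun b => ⟨?_, ?_⟩, t, rfl⟩
  · obtain ⟨a, ha⟩ := hc'_eq b
    rw [ha, h_idem]
  · have h_corner : dist (ofCube hc' t) (vertex G (c' b)) ≤ N :=
      (dist_ofCube_vertex_le hc' t b).trans (by exact_mod_cast hN m c' hc')
    have h_dist : dist (vertex G (φ o)) (vertex G (c' b)) ≤ dist (vertex G (φ o)) x + r + N :=
      (dist_triangle4 _ x (ofCube hc' t) _).trans
        (add_le_add (add_le_add le_rfl hy) h_corner)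
    exact_mod_cast ((hK_dist _ _).trans (mul_le_mul_of_nonneg_left h_dist hK)).trans
      (Nat.le_ceil _)

theorem exists_isLengthSubspace (hdim : FiniteDimensional G) {S : Set ℝ} {f : S → CubeComplex G}
    (hf : IsQuasiIsometry f) : ∃ Z : Set (CubeComplex G), IsLengthSubspace Z ∧
      HasRelCompactBalls Z ∧ ∃ C, ∀ k, ∃ z ∈ Z, dist z (f k) ≤ C := by
  have : Nonempty S := by
    obtain ⟨o⟩ := (connected (G := G)).nonempty
    obtain ⟨q, -, -, h_dense⟩ := hf
    exact (h_dense (vertex G o)).nonempty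
  obtain ⟨D, hD⟩ := exists_forall_exists_dist_vertex_le hdim
  choose v hv using hD
  obtain ⟨R, hR⟩ := exists_dist_med_le hdim hf fun k => hv (f k)
  obtain ⟨𝒜, ℬ, φ, hφ, hφ_dist⟩ := exists_isEndRetraction_of_dist_med_le hdim hR
  have h_cub : IsCubical G φ := hφ.isCubical
  refine ⟨Set.range (map h_cub),
    isLengthSubspace_univ.range (lipschitzWith_map h_cub) (map_map h_cub hφ.apply_apply),
    hasRelCompactBalls_range_map hdim h_cub hφ.apply_apply
      fun o ho => hφ.finite_setOf_dist_le hdim ho,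
    R + D, fun k => ⟨_, ⟨vertex G (v (f k)), rfl⟩, ?_⟩⟩
  rw [map_vertex]
  refine (dist_triangle _ (vertex G (v (f k))) _).trans (add_le_add ?_ (hv (f k)))
  rw [dist_comm]
  exact (dist_vertex_le _ _).trans (by exact_mod_cast hφ_dist k)

end CubeComplex

theorem IsQuasiIsometry.not_isBounded {X Y : Type*} [PseudoMetricSpace X] [PseudoMetricSpace Y]
    {f : X → Y} (hf : IsQuasiIsometry f) (hX : ¬Bornology.IsBounded (Set.univ : Set X))
    {Z : Set Y} {C : ℝ} (hfZ : ∀ x, ∃ z ∈ Z, dist z (f x) ≤ C) : ¬Bornology.IsBounded Z := by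
  intro hZ
  obtain ⟨o⟩ : Nonempty X := by
    by_contra! h
    exact hX (Set.univ_eq_empty_iff.mpr h ▸ Bornology.isBounded_empty)
  obtain ⟨r, hr⟩ := hZ.subset_closedBall (f o)
  obtain ⟨ρ, hρ⟩ := hf.exists_forall_le_dist o (f o) (r + C + 1)
  refine hX ((Metric.isBounded_closedBall (x := o) (r := ρ)).subset fun x _ => ?_)
  by_contra hx
  obtain ⟨z, hz, hzx⟩ := hfZ x
  have h_far := hρ x (le_of_not_ge hx)
  have h_near : dist z (f o) ≤ r := hr hz
  linarith [dist_triangle_left (f x) (f o) z]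

theorem mainTheorem11_general {V : Type*} (G : SimpleGraph V) [IsMedianGraph G]
    (hdim : CubeComplex.FiniteDimensional G) {S : Set ℝ} (h : QuasiIsometric S (CubeComplex G)) :
    (¬BddBelow S → ¬BddAbove S → ∃ γ : ℝ → CubeComplex G, Isometry γ) ∧
    (¬Bornology.IsBounded S → ∃ γ : Set.Ici (0 : ℝ) → CubeComplex G, Isometry γ) := by
  obtain ⟨f, hf⟩ := h
  obtain ⟨Z, hZ, hZ_balls, C, hfZ⟩ := CubeComplex.exists_isLengthSubspace hdim hf
  refine ⟨fun hS_below hS_above => hZ.exists_isometry_real hZ_balls hf hS_below hS_above hfZ,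
    fun hS => hZ.exists_isometry_Ici hZ_balls (hf.not_isBounded (fun hS' => hS ?_) hfZ)⟩
  simpa using Bornology.isBounded_image_subtype_val.mpr hS'

theorem mainTheorem11 {V : Type*} (G : SimpleGraph V) [IsMedianGraph G]
    (hdim : CubeComplex.FiniteDimensional G) :
    (QuasiIsometric ℝ (CubeComplex G) → ∃ γ : ℝ → CubeComplex G, Isometry γ) ∧
    (QuasiIsometric (Set.Ici (0 : ℝ)) (CubeComplex G) →
      ∃ γ : Set.Ici (0 : ℝ) → CubeComplex G, Isometry γ) := by
  have e : (Set.univ : Set ℝ) ≃ᵢ ℝ := ⟨Equiv.Set.univ ℝ, isometry_subtype_coe⟩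
  refine ⟨fun h => (mainTheorem11_general G hdim (h.comp_isometryEquiv e)).1
      not_bddBelow_univ not_bddAbove_univ, fun h => (mainTheorem11_general G hdim h).2
      fun hb => not_bddAbove_Ici 0 hb.bddAbove⟩
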